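/- **Setting.** Let $X\subseteq\mathbb R^n$ be closed and convex, let $P\subseteq\{p\in\mathbb R^m: p_i\ge 0,\ \sum_i p_i=1\}$ be closed and convex, and let $\Pi_i\subseteq\mathbb R^{m_i}$ ($i=1,\dots,m$) be closed, convex and bounded. Let $A_i\in\mathbb R^{m_i\times n}$, and let $f_i^*$, $\rho^*$, $u$ be proper closed convex (extended-real-valued) functions, finite at some point of $\Pi_i$, $P$, $X$ respectively. Consider the structured non-smooth risk-averse problem $$\min_{x\in X} f(x):=\max_{p\in P}\Big\{\sum_{i=1}^m p_i f_i(x)-\rho^*(p)\Big\}+u(x),\qquad f_i(x)=\max_{\pi_i\in\Pi_i}\langle A_ix,\pi_i\rangle-f_i^*(\pi_i),$$ and assume that it has an optimal solution $x^*\in X$. Let $\|\cdot\|_U$ be a norm on $\mathbb R^m$ and $U(p;q)=\omega(p)-\omega(q)-\langle\omega'(q),p-q\rangle$ the Bregman distance of a function $\omega$ that is differentiable on $P$ and 1-strongly convex on $P$ with respect to $\|\cdot\|_U$, and suppose that $D_P:=\sup_{p,q\in P}\sqrt{2U(p;q)}<\infty$. Put $$M_A=\max_i\|A_i\|,\quad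 D_\Pi=\max_i\max_{\pi_i,\bar\pi_i\in\Pi_i}\|\pi_i-\bar\pi_i\|,\quad \|v\|_{2,U^*}=\max_{\|p\|_U\le1,\|y\|\le1}\sum_i p_i\langle v_i,y\rangle,\quad \tilde M=\max_{\pi\in\Pi}\|[A_1^\top\pi_1;\dots;A_m^\top\pi_m]\|_{2,U^*}.$$ **DRAO-S method.** Start from $x^0=x^{-1}=y^0\in X$, $\tilde p^{\,0}=\tilde{\tilde p}^{\,0}\in P$, $\pi_i^0\in\Pi_i$. In phase $t=1,\dots,N$: * $\tilde x^t=x^{t-1}+\theta_t(x^{t-1}-x^{t-2})$; $\ \pi_i^t\in\arg\max_{\pi_i\in\Pi_i}\langle A_i\tilde x^t,\pi_i\rangle-f_i^*(\pi_i)-\frac{\tau_t}2\|\pi_i-\pi_i^{t-1}\|^2$; $\ v_i^t=A_i^\top\pi_i^t$ (and $v_i^0:=v_i^1$). * Inner loop: set $y^{t,0}=y^{t-1}$, $p^{t,0}=\tilde p^{\,t-1}$, $p^{t,-1}=\tilde{\tilde p}^{\,t-1}$, and for $s=1,\dots,S_t$ $$\tilde v^{s}=\begin{cases}\sum_i p_i^{t,0}v_i^t+\delta_1^t\sum_i(p_i^{t,0}-p_i^{t,-1})v_i^{t-1},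 & s=1,\\ \sum_i p_i^{t,s-1}v_i^t+\delta_s^t\sum_i(p_i^{t,s-1}-p_i^{t,s-2})v_i^{t}, & s\ge2,\end{cases}$$ $$y^{t,s}\in\arg\min_{y\in X}\langle y,\tilde v^s\rangle+u(y)+\tfrac{\beta_s^t}2\|y-y^{t,s-1}\|^2+\tfrac{\eta_t}2\|y-x^{t-1}\|^2,$$ $$p^{t,s}\in\arg\max_{p\in P}\sum_ip_i(\langle v_i^t,y^{t,s}\rangle-f_i^*(\pi_i^t))-\rho^*(p)-\gamma_s^tU(p;p^{t,s-1}).$$ * $x^t=\sum_s q_s^ty^{t,s}/\sum_sq_s^t$, $\ y^t=y^{t,S_t}$, $\ \tilde p^{\,t}=p^{t,S_t}$, $\ \tilde{\tilde p}^{\,t}=p^{t,S_t-1}$. Output $\bar x^N=\sum_{t=1}^N w_tx^t/\sum_{t=1}^Nw_t$. A phase uses two communication rounds and $S_t$ $P$-projections. Let $R_0\ge\|x^0-x^*\|$, $\Delta>0$, and $M_t=\|v^t\|_{2,U^*}$. Below, $\lceil a\rceil$ is read as $1$ if $a=0$. **Theorem.** (a) Let $R_0>0$, and let $w_t=1$,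 $\theta_t=1$, $\eta_t=M_AD_\Pi/R_0$, $\tau_t=M_AR_0/D_\Pi$, $S_t=\lceil M_t\Delta\rceil$, $\bar M_t=S_t/\Delta$, $\beta_s^t=D_P\bar M_t/R_0$, $\gamma_s^t=R_0\bar M_t/D_P$, $q_s^t=1$, $\delta_1^1=1$, $\delta_1^t=\bar M_t/\bar M_{t-1}$ for $t\ge2$, and $\delta_s^t=1$ for $s\ge2$. (If $D_\Pi=0$ or $D_P=0$, the quotient with that denominator is taken to be $0$; it then has no influence on the iterates, the corresponding sets being singletons.) Then for every $N\ge1$ $$f(\bar x^N)-f(x^*)\le\frac{M_AD_\Pi R_0}{N}+\frac{D_PR_0}{\Delta N}.$$ If $\Delta=D_P/(M_AD_\Pi)$ (with $M_A,D_\Pi,D_P>0$), then $f(\bar x^N)-f(x^*)\le 2M_AD_\Pi R_0/N$. In this case, for each $\varepsilon>0$, $N=\lceil 2M_AD_\Pi R_0/\varepsilon\rceil$ phases give $\bar x^N\in X$ with $f(\bar x^N)-f(x^*)\le\varepsilon$, using at most $2\big(\frac{2M_AD_\Pi R_0}{\varepsilon}+1\big)$ communication rounds and at most $\big(\frac{2M_AD_\Pi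 R_0}{\varepsilon}+1\big)\big(1+\frac{\tilde MD_P}{M_AD_\Pi}\big)$ $P$-projections. (b) Let $u$ be $\alpha$-strongly convex with $\alpha>0$, and let $w_t=t$, $\theta_t=(t-1)/t$, $\eta_t=t\alpha/6$, $\tau_t=6M_A^2/(t\alpha)$, $S_t=\lceil\Delta\tilde M^2\rceil$, $\gamma_s^t=4\tilde M^2/(\alpha t)$, $\beta_1^t=\frac\alpha4(t-1)$ and $\beta_s^t=\frac\alpha4t$ for $s\ge2$, $\delta_1^t=(t-1)/t$ and $\delta_s^t=1$ for $s\ge2$, $q_s^t=1$. Then for every $N\ge1$ $$f(\bar x^N)-f(x^*)\le\frac1{N(N+1)}\Big(\frac\alpha6R_0^2+\frac{6M_A^2D_\Pi^2}\alpha+\frac{4D_P^2}{\alpha\Delta}\Big).$$ If $\Delta=D_P^2/(M_A^2D_\Pi^2+\alpha^2R_0^2/6)$ (with a positive denominator and $D_P>0$), then $f(\bar x^N)-f(x^*)\le\frac{1}{N(N+1)}\big(\alpha R_0^2+\frac{10M_A^2D_\Pi^2}\alpha\big)$. In this case, for each $\varepsilon>0$, with $C=\alpha R_0^2+10M_A^2D_\Pi^2/\alpha$,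 $N=\lceil\sqrt{C/\varepsilon}\,\rceil$ phases give $\bar x^N\in X$ with $f(\bar x^N)-f(x^*)\le\varepsilon$, using at most $2(\sqrt{C/\varepsilon}+1)$ communication rounds and at most $(\sqrt{C/\varepsilon}+1)\big(1+\frac{\tilde M^2D_P^2}{M_A^2D_\Pi^2+\alpha^2R_0^2/6}\big)$ $P$-projections. -/

import Mathlib

open scoped BigOperators

noncomputable section

namespace DRAOS

/-- Euclidean space `ℝⁿ`. -/
abbrev Vec (n : ℕ) : Type := EuclideanSpace ℝ (Fin n)

/-- A proper, closed and convex extended-real-valued function: it never takes the value `-∞`,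
is not identically `+∞`, and its epigraph is closed and convex. -/
structure ProperClosedConvex {E : Type*} [NormedAddCommGroup E] [NormedSpace ℝ E]
    (φ : E → EReal) : Prop where
  ne_bot : ∀ x, φ x ≠ ⊥
  exists_ne_top : ∃ x, φ x ≠ ⊤
  isClosed_epi : IsClosed {z : E × ℝ | φ z.1 ≤ (z.2 : EReal)}
  convex_epi : Convex ℝ {z : E × ℝ | φ z.1 ≤ (z.2 : EReal)}

/-- `φ` is strongly convex with modulus `α` with respect to the norm of `E`. -/
def StronglyConvex {E : Type*} [NormedAddCommGroup E] [NormedSpace ℝ E]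
    (α : ℝ) (φ : E → EReal) : Prop :=
  ∀ x y : E, ∀ a b : ℝ, 0 < a → 0 < b → a + b = 1 →
    φ (a • x + b • y) + ((α / 2 * a * b * ‖x - y‖ ^ 2 : ℝ) : EReal)
      ≤ (a : EReal) * φ x + (b : EReal) * φ y

/-- The data of a structured non-smooth risk-averse problem
`min_{x ∈ X} max_{p ∈ P} ∑ i, p i * f i x - ρ*(p) + u x`, where
`f i x = max_{π ∈ Π i} ⟪A i x, π⟫ - f*_i(π)`. -/
structure Problem (n m : ℕ) where
  /-- the dimensions of the dual spaces -/
  k : Fin m → ℕ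
  X : Set (Vec n)
  P : Set (Fin m → ℝ)
  Dual : ∀ i, Set (Vec (k i))
  A : ∀ i, Vec n →L[ℝ] Vec (k i)
  fstar : ∀ i, Vec (k i) → EReal
  rhoStar : (Fin m → ℝ) → EReal
  u : Vec n → EReal
  isClosed_X : IsClosed X
  convex_X : Convex ℝ X
  isClosed_P : IsClosed P
  convex_P : Convex ℝ P
  P_subset : P ⊆ stdSimplex ℝ (Fin m)
  isClosed_Dual : ∀ i, IsClosed (Dual i)
  convex_Dual : ∀ i, Convex ℝ (Dual i)
  isBounded_Dual : ∀ i, Bornology.IsBounded (Dual i)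
  fstar_pcc : ∀ i, ProperClosedConvex (fstar i)
  rhoStar_pcc : ProperClosedConvex rhoStar
  u_pcc : ProperClosedConvex u
  -- the three functions are finite somewhere on the sets over which they are used
  fstar_dom : ∀ i, ∃ π ∈ Dual i, fstar i π ≠ ⊤
  rhoStar_dom : ∃ p ∈ P, rhoStar p ≠ ⊤
  u_dom : ∃ x ∈ X, u x ≠ ⊤

namespace Problem

variable {n m : ℕ} (pb : Problem n m)

/-- The scenario cost `f_i`. -/
def scenarioCost (i : Fin m) (x : Vec n) : EReal :=
  ⨆ π ∈ pb.Dual i, ((inner ℝ (pb.A i x) π : ℝ) : EReal) - pb.fstar i π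

/-- The risk-averse objective `f`. -/
def objective (x : Vec n) : EReal :=
  (⨆ p ∈ pb.P, (∑ i, (p i : EReal) * pb.scenarioCost i x) - pb.rhoStar p) + pb.u x

/-- `x` is an optimal solution of the problem. -/
def IsOptimal (x : Vec n) : Prop := x ∈ pb.X ∧ IsMinOn pb.objective pb.X x

/-- `M_A`, the largest operator norm of the `A i`. -/
def MA : ℝ := ⨆ i, ‖pb.A i‖

/-- `D_Π`, the largest diameter of the dual sets. -/
def DDual : ℝ := ⨆ i, Metric.diam (pb.Dual i)

/-- The vectors `v_i = A_iᵀ π_i`. -/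
def v (π : ∀ i, Vec (pb.k i)) (i : Fin m) : Vec n :=
  ContinuousLinearMap.adjoint (pb.A i) (π i)

end Problem

/-- The Bregman distance `U(p; q) = ω(p) - ω(q) - ⟨ω'(q), p - q⟩` on `P`. The derivative is taken
relative to `P`; on the directions `p - q` with `p, q ∈ P` it is uniquely determined. -/
def bregman {m : ℕ} (P : Set (Fin m → ℝ)) (ω : (Fin m → ℝ) → ℝ) (p q : Fin m → ℝ) : ℝ :=
  ω p - ω q - fderivWithin ℝ ω P q (p - q)

/-- A norm `‖·‖_U` on `ℝᵐ` and a distance generating function `ω`, differentiable on `P` and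
1-strongly convex on `P` with respect to `‖·‖_U`, whose Bregman distance is bounded on `P × P`. -/
structure ProxSetup {m : ℕ} (P : Set (Fin m → ℝ)) where
  normU : Seminorm ℝ (Fin m → ℝ)
  normU_eq_zero : ∀ p, normU p = 0 → p = 0
  ω : (Fin m → ℝ) → ℝ
  differentiableOn : DifferentiableOn ℝ ω P
  strongly_convex : ∀ p ∈ P, ∀ q ∈ P, normU (p - q) ^ 2 / 2 ≤ bregman P ω p q
  bddAbove : BddAbove {r : ℝ | ∃ p ∈ P, ∃ q ∈ P, r = √(2 * bregman P ω p q)}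

namespace ProxSetup

variable {m : ℕ} {P : Set (Fin m → ℝ)} (px : ProxSetup P)

/-- The Bregman distance `U(p; q)`. -/
def U (p q : Fin m → ℝ) : ℝ := bregman P px.ω p q

/-- `D_P`, the radius of `P`. -/
def DP : ℝ := sSup {r : ℝ | ∃ p ∈ P, ∃ q ∈ P, r = √(2 * px.U p q)}

/-- The operator norm `‖v‖_{2,U*}` of a stacked matrix with rows `v_i`. -/
def opNorm {n : ℕ} (v : Fin m → Vec n) : ℝ :=
  sSup {r : ℝ | ∃ p : Fin m → ℝ, ∃ y : Vec n, px.normU p ≤ 1 ∧ ‖y‖ ≤ 1 ∧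
    r = ∑ i, p i * inner ℝ (v i) y}

end ProxSetup

/-- The uniform bound `M̃_{AΠ}`, the largest `‖[A_1ᵀ π_1; …; A_mᵀ π_m]‖_{2,U*}` over `π ∈ Π`. -/
def MTilde {n m : ℕ} (pb : Problem n m) (px : ProxSetup pb.P) : ℝ :=
  sSup {r : ℝ | ∃ π : ∀ i, Vec (pb.k i), (∀ i, π i ∈ pb.Dual i) ∧ r = px.opNorm (pb.v π)}

/-- Stepsizes, weights and inner iteration limits; the first index is the phase `t`, the second
one, if present, is the inner iteration `s`. -/
structure Stepsizes where
  w : ℕ → ℝ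
  θ : ℕ → ℝ
  η : ℕ → ℝ
  τ : ℕ → ℝ
  S : ℕ → ℕ
  δ : ℕ → ℕ → ℝ
  γ : ℕ → ℕ → ℝ
  β : ℕ → ℕ → ℝ
  q : ℕ → ℕ → ℝ

/-- The momentum prediction `ṽ^s` of the sliding subroutine, for `s ≥ 1`. -/
def momentum {n m : ℕ} (v vPrev : Fin m → Vec n) (p : ℕ → Fin m → ℝ) (pPrev : Fin m → ℝ)
    (δ : ℕ → ℝ) (s : ℕ) : Vec n :=
  if s = 1 then ∑ i, p 0 i • v i + δ 1 • ∑ i, (p 0 i - pPrev i) • vPrev i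
  else ∑ i, p (s - 1) i • v i + δ s • ∑ i, (p (s - 1) i - p (s - 2) i) • v i

/-- `y 0, …, y S` and `p 0, …, p S` are iterates of the saddle point sliding subroutine with
prox center `xPrev`, gradients `v` and `vPrev`, conjugate values `c i = f*_i(π_i)`, and with
`pPrev` in the role of `p^{-1}`. -/
structure IsSPS {n m : ℕ} (pb : Problem n m) (px : ProxSetup pb.P)
    (xPrev : Vec n) (pPrev : Fin m → ℝ) (v vPrev : Fin m → Vec n) (c : Fin m → EReal)
    (η : ℝ) (δ γ β : ℕ → ℝ) (S : ℕ) (y : ℕ → Vec n) (p : ℕ → Fin m → ℝ) : Prop where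
  y_mem : ∀ s, 1 ≤ s → s ≤ S → y s ∈ pb.X
  y_min : ∀ s, 1 ≤ s → s ≤ S → IsMinOn (fun z : Vec n =>
      ((inner ℝ z (momentum v vPrev p pPrev δ s) + β s / 2 * ‖z - y (s - 1)‖ ^ 2
        + η / 2 * ‖z - xPrev‖ ^ 2 : ℝ) : EReal) + pb.u z) pb.X (y s)
  p_mem : ∀ s, 1 ≤ s → s ≤ S → p s ∈ pb.P
  p_max : ∀ s, 1 ≤ s → s ≤ S → IsMaxOn (fun r : Fin m → ℝ =>
      (∑ i, (r i : EReal) * (((inner ℝ (v i) (y s) : ℝ) : EReal) - c i)) - pb.rhoStar r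
        - ((γ s * px.U r (p (s - 1)) : ℝ) : EReal)) pb.P (p s)

/-- The sequences produced by the DRAO-S method: `x t` and `dual t` are the outer iterates, and
`y t s`, `p t s` are the inner iterates of phase `t`. -/
structure Iterates {n m : ℕ} (pb : Problem n m) where
  x : ℕ → Vec n
  dual : ℕ → ∀ i, Vec (pb.k i)
  y : ℕ → ℕ → Vec n
  p : ℕ → ℕ → Fin m → ℝ

/-- The first `N` phases of `it` are generated by the DRAO-S method with the stepsizes `st`.
The initial points are `x 0 = x^0 = x^{-1}`, `dual 0 = π^0`, `y 1 0 = y^0 = x^0` and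
`p 1 0`, which is the common value of the two initial points in `P`. For `t = 1` the truncated
index `t - 2` equals `0`, in accordance with `x^{-1} = x^0`. -/
structure IsDRAOS {n m : ℕ} (pb : Problem n m) (px : ProxSetup pb.P) (st : Stepsizes) (N : ℕ)
    (it : Iterates pb) : Prop where
  x_zero : it.x 0 ∈ pb.X
  dual_zero : ∀ i, it.dual 0 i ∈ pb.Dual i
  y_init : it.y 1 0 = it.x 0
  p_init : it.p 1 0 ∈ pb.P
  y_next : ∀ t, 2 ≤ t → t ≤ N → it.y t 0 = it.y (t - 1) (st.S (t - 1))
  p_next : ∀ t, 2 ≤ t → t ≤ N → it.p t 0 = it.p (t - 1) (st.S (t - 1))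
  dual_mem : ∀ t, 1 ≤ t → t ≤ N → ∀ i, it.dual t i ∈ pb.Dual i
  dual_max : ∀ t, 1 ≤ t → t ≤ N → ∀ i, IsMaxOn (fun π : Vec (pb.k i) =>
      ((inner ℝ (pb.A i (it.x (t - 1) + st.θ t • (it.x (t - 1) - it.x (t - 2)))) π
        - st.τ t / 2 * ‖π - it.dual (t - 1) i‖ ^ 2 : ℝ) : EReal) - pb.fstar i π)
      (pb.Dual i) (it.dual t i)
  sps : ∀ t, 1 ≤ t → t ≤ N →
      IsSPS pb px (it.x (t - 1))
        (if t = 1 then it.p 1 0 else it.p (t - 1) (st.S (t - 1) - 1))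
        (pb.v (it.dual t))
        (if t = 1 then pb.v (it.dual 1) else pb.v (it.dual (t - 1)))
        (fun i => pb.fstar i (it.dual t i))
        (st.η t) (st.δ t) (st.γ t) (st.β t) (st.S t) (it.y t) (it.p t)
  x_next : ∀ t, 1 ≤ t → t ≤ N →
      it.x t = (∑ s ∈ Finset.Icc 1 (st.S t), st.q t s)⁻¹ •
        ∑ s ∈ Finset.Icc 1 (st.S t), st.q t s • it.y t s

/-- The returned ergodic solution `x̄^N`. -/
def Iterates.average {n m : ℕ} {pb : Problem n m} (it : Iterates pb) (st : Stepsizes) (N : ℕ) :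
    Vec n :=
  (∑ t ∈ Finset.Icc 1 N, st.w t)⁻¹ • ∑ t ∈ Finset.Icc 1 N, st.w t • it.x t

/-- The operator norms `M_t = ‖v^t‖_{2,U*}` met along the iterates. -/
def Iterates.M {n m : ℕ} {pb : Problem n m} (it : Iterates pb) (px : ProxSetup pb.P) (t : ℕ) : ℝ :=
  px.opNorm (pb.v (it.dual t))

/-- The number of communication rounds in `N` phases: two rounds per phase. -/
def commRounds (N : ℕ) : ℕ := 2 * N

/-- The number of `P`-projections in `N` phases: one per inner iteration. -/
def pProjections (st : Stepsizes) (N : ℕ) : ℕ := ∑ t ∈ Finset.Icc 1 N, st.S t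

/-- The inner iteration limit `⌈a⌉` for `a > 0`; it is `1` for `a = 0`. -/
def innerLimit (a : ℝ) : ℕ := max 1 ⌈a⌉₊

/-- The stepsizes for merely convex `u`; `M t` stands for `‖v^t‖_{2,U*}`, and
`M̄_t = S_t / Δ`. -/
def convexStepsizes (MA DDual DP R₀ Δ : ℝ) (M : ℕ → ℝ) : Stepsizes where
  w _ := 1
  θ _ := 1
  η _ := MA * DDual / R₀
  τ _ := MA * R₀ / DDual
  S t := innerLimit (M t * Δ)
  δ t s := if s = 1 ∧ 2 ≤ t then
      ((innerLimit (M t * Δ) : ℝ) / Δ) / ((innerLimit (M (t - 1) * Δ) : ℝ) / Δ) else 1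
  γ t _ := R₀ * ((innerLimit (M t * Δ) : ℝ) / Δ) / DP
  β t _ := DP * ((innerLimit (M t * Δ) : ℝ) / Δ) / R₀
  q _ _ := 1

/-- The stepsizes for `α`-strongly convex `u`; `Mt` stands for `M̃_{AΠ}`. -/
def strongStepsizes (α MA Mt Δ : ℝ) : Stepsizes where
  w t := t
  θ t := (t - 1 : ℝ) / t
  η t := t * α / 6
  τ t := 6 * MA ^ 2 / (t * α)
  S _ := innerLimit (Δ * Mt ^ 2)
  δ t s := if s = 1 then (t - 1 : ℝ) / t else 1
  γ t _ := 4 * Mt ^ 2 / (α * t)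
  β t s := if s = 1 then α / 4 * (t - 1 : ℝ) else α / 4 * t
  q _ _ := 1

end DRAOS

end

noncomputable section

namespace DRAOS

/-! ### Three-point inequalities for Euclidean and Bregman prox steps -/

section Prox

variable {E : Type*} [NormedAddCommGroup E] [InnerProductSpace ℝ E]

/-! The objective is the supremum over p and π of the saddle function, which is convex in x. So it
suffices to fix a comparison pair (r, π) with finite values, to bound the weighted sum of
saddle(x^t, r, π) - f(x*) uniformly in that pair, and to apply Jensen's inequality to the average.
Optimality of x* serves only to place it in `domX`; the rates hold against any point of `domX`.

One phase splits this gap in two. The part saddle(x^t, r, π) - saddle(x^t, r, π^t) is an r-average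
of the errors of the separate dual prox steps (`dual_step`). The part saddle(x^t, r, π^t) - f(x*) is
handled by the inner loop, since f(x*) dominates saddle(x*, p^{t,s}, π^t); Jensen passes from the
y^{t,s} to x^t (`phase_progress_le`).

Both parts rest on the same mechanism. A prox step satisfies a three-point inequality
(`prox_growth`, `bregman_prox`), so distances to the comparison point telescope. The momentum makes
the bilinear error telescope as well, up to a product of two successive displacements; Young's
inequality charges that product to the squared displacements left over by the prox steps
(`inner_step_aux`, `inner_step`). Phases are glued together because phase t starts from the last
inner iterates of phase t-1 and its first momentum term uses the old v^{t-1}: with δ_1^t equal to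
the ratio of the inner weights w/S, the inner potential passes through the change of phase
(`first_step`).

Strong convexity gives α/2 per inner step. One half goes into the inner potential and lets β grow;
the other half survives Jensen and lets η grow.

The result is a potential that decreases by the gap (`phase_step`), is bounded by the initial
distances (`phase_one`) and is nonnegative at the end (`outerPotential_nonneg`).
`StepsizeConditions` isolates what this needs; both stepsize rules satisfy it, and the two rates are
evaluations of the initial bound. -/

theorem nonneg_of_forall_mul_add_sq {A B : ℝ}
    (h : ∀ l : ℝ, 0 < l → l < 1 → 0 ≤ l * A + l ^ 2 * B) : 0 ≤ A := by
  by_contra hA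
  push Not at hA
  have hB : 0 < |B| + 1 := by positivity
  -- For l below -A / (|B| + 1) the linear term beats the quadratic one.
  obtain ⟨l, hl0, hl⟩ := exists_between (lt_min one_pos (div_pos (neg_pos.2 hA) hB))
  have h1 := h l hl0 (lt_of_lt_of_le hl (min_le_left _ _))
  have h2 : l * (|B| + 1) < -A := (lt_div_iff₀ hB).1 (lt_of_lt_of_le hl (min_le_right _ _))
  have h3 : 0 ≤ A + l * B := by
    have : 0 ≤ l * (A + l * B) := by linarith
    exact nonneg_of_mul_nonneg_right this hl0
  nlinarith [le_abs_self B]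

theorem norm_segment_sub_sq (y z a : E) (l : ℝ) :
    ‖((1 - l) • y + l • z) - a‖ ^ 2
      = (1 - l) * ‖y - a‖ ^ 2 + l * ‖z - a‖ ^ 2 - l * (1 - l) * ‖z - y‖ ^ 2 := by
  have e1 : ((1 - l) • y + l • z) - a = (y - a) + l • (z - y) := by module
  have e2 : z - a = (y - a) + (z - y) := by abel
  rw [e1, e2, norm_add_sq_real, norm_add_sq_real, inner_smul_right, norm_smul, mul_pow,
    Real.norm_eq_abs, sq_abs]
  ring

/-- Quadratic growth of a strongly convex composite objective at its minimizer. -/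
theorem prox_growth {φ : E → ℝ} {y z v a b : E} {α β η : ℝ}
    (hconv : ∀ l : ℝ, 0 < l → l < 1 →
      φ ((1 - l) • y + l • z) + α / 2 * (1 - l) * l * ‖z - y‖ ^ 2 ≤ (1 - l) * φ y + l * φ z)
    (hmin : ∀ l : ℝ, 0 < l → l < 1 →
      inner ℝ y v + β / 2 * ‖y - a‖ ^ 2 + η / 2 * ‖y - b‖ ^ 2 + φ y
        ≤ inner ℝ ((1 - l) • y + l • z) v + β / 2 * ‖((1 - l) • y + l • z) - a‖ ^ 2
          + η / 2 * ‖((1 - l) • y + l • z) - b‖ ^ 2 + φ ((1 - l) • y + l • z)) :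
    inner ℝ y v + β / 2 * ‖y - a‖ ^ 2 + η / 2 * ‖y - b‖ ^ 2 + φ y
        + (α + β + η) / 2 * ‖z - y‖ ^ 2
      ≤ inner ℝ z v + β / 2 * ‖z - a‖ ^ 2 + η / 2 * ‖z - b‖ ^ 2 + φ z := by
  rw [← sub_nonneg]
  -- Moving from y towards z, the quadratic terms gain l(1 - l)(α + β + η)/2 ‖z - y‖² over the
  -- chord. The l² part of this gain is `B` and disappears as l → 0.
  refine nonneg_of_forall_mul_add_sq (B := (α + β + η) / 2 * ‖z - y‖ ^ 2) fun l hl0 hl1 => ?_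
  have h1 := hconv l hl0 hl1
  have h2 := hmin l hl0 hl1
  rw [norm_segment_sub_sq, norm_segment_sub_sq, inner_add_left, real_inner_smul_left,
    real_inner_smul_left] at h2
  linarith

end Prox

/-- First-order optimality along the segment from p to z, combined with the three-point identity for
Bregman distances. Since P lies in a simplex, ω is differentiated only within P, and only the
one-sided derivative in the direction z - p is used. -/
theorem bregman_prox {m : ℕ} {P : Set (Fin m → ℝ)} {ω ψ : (Fin m → ℝ) → ℝ} {p p' z : Fin m → ℝ}
    {γ : ℝ} (hP : Convex ℝ P) (hω : DifferentiableOn ℝ ω P) (hp : p ∈ P) (hz : z ∈ P)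
    (hconc : ∀ l : ℝ, 0 < l → l < 1 → (1 - l) * ψ p + l * ψ z ≤ ψ ((1 - l) • p + l • z))
    (hmax : ∀ l : ℝ, 0 < l → l < 1 →
      ψ ((1 - l) • p + l • z) - γ * bregman P ω ((1 - l) • p + l • z) p'
        ≤ ψ p - γ * bregman P ω p p') :
    ψ z + γ * (bregman P ω z p + bregman P ω p p' - bregman P ω z p') ≤ ψ p := by
  set g : ℝ → ℝ := fun l => ω ((1 - l) • p + l • z) with hg
  have hline : HasDerivWithinAt (fun l : ℝ => (1 - l) • p + l • z) (z - p) (Set.Ioo 0 1) 0 := by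
    have h1 : HasDerivAt (fun l : ℝ => p + l • (z - p)) (z - p) 0 := by
      simpa using ((hasDerivAt_id (0 : ℝ)).smul_const (z - p)).const_add p
    refine (h1.congr_of_eventuallyEq (Filter.Eventually.of_forall fun l => ?_)).hasDerivWithinAt
    module
  have hderiv : HasDerivWithinAt g (fderivWithin ℝ ω P p (z - p)) (Set.Ioo 0 1) 0 := by
    have h0 : (fun l : ℝ => (1 - l) • p + l • z) 0 = p := by simp
    have h2 : HasFDerivWithinAt ω (fderivWithin ℝ ω P p) P
        ((fun l : ℝ => (1 - l) • p + l • z) 0) := by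
      rw [h0]; exact (hω p hp).hasFDerivWithinAt
    refine h2.comp_hasDerivWithinAt (0 : ℝ) hline fun l hl => ?_
    exact hP hp hz (by linarith [hl.2]) hl.1.le (by ring)
  have hnm : (0 : ℝ) ∉ Set.Ioo (0 : ℝ) 1 := by simp
  rw [hasDerivWithinAt_iff_tendsto_slope' hnm] at hderiv
  have hne : (nhdsWithin (0 : ℝ) (Set.Ioo 0 1)).NeBot := by
    rw [nhdsWithin_Ioo_eq_nhdsGT one_pos]; infer_instance
  have hlim := (hderiv.sub_const (fderivWithin ℝ ω P p' (z - p))).const_mul γ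
  -- Maximality at p compared with the point at parameter l, divided by l, in the limit l → 0.
  have key : ψ z - ψ p
      ≤ γ * (fderivWithin ℝ ω P p (z - p) - fderivWithin ℝ ω P p' (z - p)) := by
    refine ge_of_tendsto hlim ?_
    filter_upwards [self_mem_nhdsWithin] with l hl
    have h1 := hconc l hl.1 hl.2
    have h2 := hmax l hl.1 hl.2
    have e1 : bregman P ω ((1 - l) • p + l • z) p' - bregman P ω p p'
        = g l - g 0 - l * fderivWithin ℝ ω P p' (z - p) := by
      have : (1 - l) • p + l • z - p' = (p - p') + l • (z - p) := by module
      simp only [bregman, hg, this, map_add, map_smul, smul_eq_mul]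
      simp
      ring
    have e2 : slope g 0 l = (g l - g 0) / l := by simp [slope_def_field]
    have h3 : l * (ψ z - ψ p) ≤ l * (γ * (slope g 0 l - fderivWithin ℝ ω P p' (z - p))) := by
      have : l * (γ * (slope g 0 l - fderivWithin ℝ ω P p' (z - p)))
          = γ * (bregman P ω ((1 - l) • p + l • z) p' - bregman P ω p p') := by
        rw [e1, e2]
        field_simp [hl.1.ne']
      rw [this]; linarith
    exact le_of_mul_le_mul_left h3 hl.1
  have e3 : bregman P ω z p + bregman P ω p p' - bregman P ω z p'
      = fderivWithin ℝ ω P p' (z - p) - fderivWithin ℝ ω P p (z - p) := by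
    have : z - p' = (z - p) + (p - p') := by abel
    simp only [bregman, this, map_add]
    ring
  rw [e3]
  linarith

/-! ### From extended-real convex functions to real inequalities -/

section Extended

variable {E : Type*} [NormedAddCommGroup E] [NormedSpace ℝ E] {φ : E → EReal}

theorem ProperClosedConvex.coe_toReal (h : ProperClosedConvex φ) {x : E} (hx : φ x ≠ ⊤) :
    ((φ x).toReal : EReal) = φ x :=
  EReal.coe_toReal hx (h.ne_bot x)

theorem ProperClosedConvex.convexOn (h : ProperClosedConvex φ) {X : Set E} (hX : Convex ℝ X) :
    ConvexOn ℝ {x | x ∈ X ∧ φ x ≠ ⊤} fun x => (φ x).toReal := by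
  have key : ∀ x, φ x ≠ ⊤ → ∀ y, φ y ≠ ⊤ → ∀ a b : ℝ, 0 ≤ a → 0 ≤ b → a + b = 1 →
      φ (a • x + b • y) ≤ ((a * (φ x).toReal + b * (φ y).toReal : ℝ) : EReal) := by
    intro x hx y hy a b ha hb hab
    have hx' : (x, (φ x).toReal) ∈ {z : E × ℝ | φ z.1 ≤ (z.2 : EReal)} := (h.coe_toReal hx).ge
    have hy' : (y, (φ y).toReal) ∈ {z : E × ℝ | φ z.1 ≤ (z.2 : EReal)} := (h.coe_toReal hy).ge
    exact h.convex_epi hx' hy' ha hb hab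
  refine ⟨fun x hx y hy a b ha hb hab => ⟨hX hx.1 hy.1 ha hb hab, ?_⟩,
    fun x hx y hy a b ha hb hab => ?_⟩
  · exact ne_top_of_le_ne_top (EReal.coe_ne_top _) (key x hx.2 y hy.2 a b ha hb hab)
  · have := key x hx.2 y hy.2 a b ha hb hab
    exact EReal.toReal_le_toReal this (h.ne_bot _) (EReal.coe_ne_top _)

theorem ProperClosedConvex.lowerSemicontinuous (h : ProperClosedConvex φ) :
    LowerSemicontinuous φ := by
  rw [lowerSemicontinuous_iff_isClosed_preimage]
  intro y
  induction y using EReal.rec with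
  | bot =>
    convert isClosed_empty
    ext x
    simp [h.ne_bot x]
  | top => convert isClosed_univ; ext x; simp
  | coe r =>
    have hc : Continuous fun x : E => (x, r) := by fun_prop
    exact h.isClosed_epi.preimage hc

theorem ProperClosedConvex.exists_lower_bound (h : ProperClosedConvex φ) {K : Set E}
    (hK : IsCompact K) : ∃ c : ℝ, ∀ x ∈ K, (c : EReal) ≤ φ x := by
  rcases K.eq_empty_or_nonempty with rfl | hne
  · exact ⟨0, by simp⟩
  obtain ⟨a, -, ha⟩ :=
    (h.lowerSemicontinuous.lowerSemicontinuousOn K).exists_isMinOn hne hK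
  -- If `φ a = ⊤`, the value is 0, which is still below `φ` on K.
  exact ⟨(φ a).toReal, fun x hx => (EReal.coe_toReal_le (h.ne_bot a)).trans (ha hx)⟩

theorem StronglyConvex.toReal_segment {α : ℝ} (hs : StronglyConvex α φ)
    (h : ProperClosedConvex φ) {x y : E} (hx : φ x ≠ ⊤) (hy : φ y ≠ ⊤) {l : ℝ} (hl0 : 0 < l)
    (hl1 : l < 1) :
    (φ ((1 - l) • x + l • y)).toReal + α / 2 * (1 - l) * l * ‖y - x‖ ^ 2
      ≤ (1 - l) * (φ x).toReal + l * (φ y).toReal := by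
  have hfin : φ ((1 - l) • x + l • y) ≠ ⊤ :=
    ((h.convexOn convex_univ).1 ⟨trivial, hx⟩ ⟨trivial, hy⟩ (by linarith) hl0.le (by ring)).2
  have := hs x y (1 - l) l (by linarith) hl0 (by ring)
  rw [← h.coe_toReal hx, ← h.coe_toReal hy, ← h.coe_toReal hfin, norm_sub_rev] at this
  exact_mod_cast this

/-- Some feasible point has a finite value, so a minimizer cannot sit where `φ` is `⊤`; after that
all comparisons are between reals. -/
theorem ProperClosedConvex.min_real (h : ProperClosedConvex φ) {X : Set E} {g : E → ℝ} {y : E}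
    (hdom : ∃ x ∈ X, φ x ≠ ⊤) (hmin : IsMinOn (fun z => (g z : EReal) + φ z) X y) :
    φ y ≠ ⊤ ∧ ∀ z ∈ X, φ z ≠ ⊤ → g y + (φ y).toReal ≤ g z + (φ z).toReal := by
  have hy : φ y ≠ ⊤ := by
    obtain ⟨x, hx, hxt⟩ := hdom
    intro hy
    have := isMinOn_iff.1 hmin x hx
    rw [hy, EReal.coe_add_top, top_le_iff, ← h.coe_toReal hxt, ← EReal.coe_add] at this
    exact EReal.coe_ne_top _ this
  refine ⟨hy, fun z hz hzt => ?_⟩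
  have := isMinOn_iff.1 hmin z hz
  rw [← h.coe_toReal hzt, ← h.coe_toReal hy] at this
  exact_mod_cast this

theorem ProperClosedConvex.max_real (h : ProperClosedConvex φ) {X : Set E} {g : E → ℝ} {y : E}
    (hdom : ∃ x ∈ X, φ x ≠ ⊤) (hmax : IsMaxOn (fun z => (g z : EReal) - φ z) X y) :
    φ y ≠ ⊤ ∧ ∀ z ∈ X, φ z ≠ ⊤ → g z - (φ z).toReal ≤ g y - (φ y).toReal := by
  have hy : φ y ≠ ⊤ := by
    obtain ⟨x, hx, hxt⟩ := hdom
    intro hy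
    have := isMaxOn_iff.1 hmax x hx
    rw [hy, EReal.sub_top, le_bot_iff, ← h.coe_toReal hxt, ← EReal.coe_sub] at this
    exact EReal.coe_ne_bot _ this
  refine ⟨hy, fun z hz hzt => ?_⟩
  have := isMaxOn_iff.1 hmax z hz
  rw [← h.coe_toReal hzt, ← h.coe_toReal hy] at this
  exact_mod_cast this

theorem coe_sum {ι : Type*} (s : Finset ι) (f : ι → ℝ) :
    ((∑ i ∈ s, f i : ℝ) : EReal) = ∑ i ∈ s, (f i : EReal) := by
  classical
  induction s using Finset.induction_on with
  | empty => simp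
  | insert a s ha ih => rw [Finset.sum_insert ha, Finset.sum_insert ha, EReal.coe_add, ih]

end Extended

/-! ### Finiteness of the objective and its saddle representation -/

namespace Problem

variable {n m : ℕ} (pb : Problem n m)

theorem isCompact_Dual (i : Fin m) : IsCompact (pb.Dual i) :=
  Metric.isCompact_of_isClosed_isBounded (pb.isClosed_Dual i) (pb.isBounded_Dual i)

theorem isCompact_P : IsCompact pb.P :=
  (isCompact_stdSimplex ℝ (Fin m)).of_isClosed_subset pb.isClosed_P pb.P_subset

/-- The points of `X` at which `u` is finite. -/
def domX : Set (Vec n) := {x | x ∈ pb.X ∧ pb.u x ≠ ⊤}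

/-- The points of `P` at which `ρ*` is finite. -/
def domP : Set (Fin m → ℝ) := {p | p ∈ pb.P ∧ pb.rhoStar p ≠ ⊤}

/-- The families of points of the `Π i` at which the `f*_i` are finite. -/
def domDual : Set (∀ i, Vec (pb.k i)) := {π | ∀ i, π i ∈ pb.Dual i ∧ pb.fstar i (π i) ≠ ⊤}

/-- The saddle function of the problem; it is meaningful on `domX`, `domP` and `domDual`. -/
def saddle (x : Vec n) (p : Fin m → ℝ) (π : ∀ i, Vec (pb.k i)) : ℝ :=
  ∑ i, p i * (inner ℝ (pb.A i x) (π i) - (pb.fstar i (π i)).toReal)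
    - (pb.rhoStar p).toReal + (pb.u x).toReal

theorem scenarioCost_ne_bot (i : Fin m) (x : Vec n) : pb.scenarioCost i x ≠ ⊥ := by
  obtain ⟨π, hπ, hf⟩ := pb.fstar_dom i
  refine ne_bot_of_le_ne_bot ?_ (le_iSup₂_of_le (f := fun π (_ : π ∈ pb.Dual i) =>
    ((inner ℝ (pb.A i x) π : ℝ) : EReal) - pb.fstar i π) π hπ le_rfl)
  rw [← (pb.fstar_pcc i).coe_toReal hf, ← EReal.coe_sub]
  exact EReal.coe_ne_bot _

theorem scenarioCost_ne_top (i : Fin m) (x : Vec n) : pb.scenarioCost i x ≠ ⊤ := by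
  obtain ⟨c, hc⟩ := (pb.fstar_pcc i).exists_lower_bound (pb.isCompact_Dual i)
  obtain ⟨C, hC⟩ := (pb.isBounded_Dual i).exists_norm_le
  refine ne_top_of_le_ne_top (EReal.coe_ne_top (‖pb.A i x‖ * C - c)) (iSup₂_le fun π hπ => ?_)
  rw [EReal.coe_sub]
  refine EReal.sub_le_sub (EReal.coe_le_coe_iff.2 ?_) (hc π hπ)
  exact (real_inner_le_norm _ _).trans (by gcongr; exact hC π hπ)

theorem coe_scenarioCost (i : Fin m) (x : Vec n) :
    ((pb.scenarioCost i x).toReal : EReal) = pb.scenarioCost i x :=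
  EReal.coe_toReal (pb.scenarioCost_ne_top i x) (pb.scenarioCost_ne_bot i x)

theorem le_scenarioCost {i : Fin m} {x : Vec n} {π : Vec (pb.k i)} (hπ : π ∈ pb.Dual i)
    (hf : pb.fstar i π ≠ ⊤) :
    inner ℝ (pb.A i x) π - (pb.fstar i π).toReal ≤ (pb.scenarioCost i x).toReal := by
  rw [← EReal.coe_le_coe_iff, pb.coe_scenarioCost, EReal.coe_sub,
    (pb.fstar_pcc i).coe_toReal hf]
  exact le_iSup₂_of_le (f := fun π (_ : π ∈ pb.Dual i) =>
    ((inner ℝ (pb.A i x) π : ℝ) : EReal) - pb.fstar i π) π hπ le_rfl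

theorem exists_scenarioCost_lt (i : Fin m) (x : Vec n) {ε : ℝ} (hε : 0 < ε) :
    ∃ π ∈ pb.Dual i, pb.fstar i π ≠ ⊤ ∧
      (pb.scenarioCost i x).toReal < inner ℝ (pb.A i x) π - (pb.fstar i π).toReal + ε := by
  have h : (((pb.scenarioCost i x).toReal - ε : ℝ) : EReal) < pb.scenarioCost i x := by
    conv_rhs => rw [← pb.coe_scenarioCost]
    exact EReal.coe_lt_coe_iff.2 (by linarith)
  obtain ⟨π, hπ, hlt⟩ := lt_biSup_iff.1 h
  have hf : pb.fstar i π ≠ ⊤ := by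
    intro hf
    rw [hf, EReal.sub_top] at hlt
    exact not_lt_bot hlt
  refine ⟨π, hπ, hf, ?_⟩
  rw [← (pb.fstar_pcc i).coe_toReal hf, ← EReal.coe_sub, EReal.coe_lt_coe_iff] at hlt
  linarith

theorem sum_mul_scenarioCost (p : Fin m → ℝ) (x : Vec n) :
    ∑ i, (p i : EReal) * pb.scenarioCost i x
      = ((∑ i, p i * (pb.scenarioCost i x).toReal : ℝ) : EReal) := by
  rw [coe_sum]
  refine Finset.sum_congr rfl fun i _ => ?_
  rw [EReal.coe_mul, pb.coe_scenarioCost]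

theorem coe_saddle_le_objective {x : Vec n} (hx : x ∈ pb.domX) {p : Fin m → ℝ}
    (hp : p ∈ pb.domP) {π : ∀ i, Vec (pb.k i)} (hπ : π ∈ pb.domDual) :
    (pb.saddle x p π : EReal) ≤ pb.objective x := by
  have h1 : ((∑ i, p i * (inner ℝ (pb.A i x) (π i) - (pb.fstar i (π i)).toReal)
      - (pb.rhoStar p).toReal : ℝ) : EReal)
      ≤ ⨆ p ∈ pb.P, (∑ i, (p i : EReal) * pb.scenarioCost i x) - pb.rhoStar p := by
    refine le_iSup₂_of_le p hp.1 ?_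
    rw [pb.sum_mul_scenarioCost, ← pb.rhoStar_pcc.coe_toReal hp.2, ← EReal.coe_sub]
    refine EReal.coe_le_coe_iff.2 (sub_le_sub_right (Finset.sum_le_sum fun i _ => ?_) _)
    exact mul_le_mul_of_nonneg_left (pb.le_scenarioCost (hπ i).1 (hπ i).2)
      ((pb.P_subset hp.1).1 i)
  rw [saddle, EReal.coe_add, pb.u_pcc.coe_toReal hx.2]
  exact add_le_add_left h1 _

/-- For fixed p the supremum over π separates over the scenarios. Choosing each π_i within ε of its
supremum costs at most ε in total, because p is a probability vector; no maximizer has to exist. -/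
theorem objective_le_of_saddle_le {x : Vec n} (hx : x ∈ pb.domX) {K : ℝ}
    (h : ∀ p ∈ pb.domP, ∀ π ∈ pb.domDual, pb.saddle x p π ≤ K) :
    pb.objective x ≤ (K : EReal) := by
  have h1 : (⨆ p ∈ pb.P, (∑ i, (p i : EReal) * pb.scenarioCost i x) - pb.rhoStar p)
      ≤ ((K - (pb.u x).toReal : ℝ) : EReal) := by
    refine iSup₂_le fun p hp => ?_
    by_cases hρ : pb.rhoStar p = ⊤
    · rw [hρ, EReal.sub_top]; exact bot_le
    rw [pb.sum_mul_scenarioCost, ← pb.rhoStar_pcc.coe_toReal hρ, ← EReal.coe_sub,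
      EReal.coe_le_coe_iff]
    refine le_of_forall_pos_le_add fun ε hε => ?_
    choose π hπ hf hlt using fun i => pb.exists_scenarioCost_lt i x hε
    have h2 := h p ⟨hp, hρ⟩ π fun i => ⟨hπ i, hf i⟩
    have h3 : ∑ i, p i * (pb.scenarioCost i x).toReal
        ≤ ∑ i, (p i * (inner ℝ (pb.A i x) (π i) - (pb.fstar i (π i)).toReal) + p i * ε) := by
      refine Finset.sum_le_sum fun i _ => ?_
      rw [← mul_add]
      exact mul_le_mul_of_nonneg_left (hlt i).le ((pb.P_subset hp).1 i)
    rw [Finset.sum_add_distrib, ← Finset.sum_mul, (pb.P_subset hp).2, one_mul] at h3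
    rw [saddle] at h2
    linarith
  calc pb.objective x ≤ ((K - (pb.u x).toReal : ℝ) : EReal) + pb.u x := add_le_add_left h1 _
    _ = (K : EReal) := by
      rw [← pb.u_pcc.coe_toReal hx.2, ← EReal.coe_add, EReal.toReal_coe, sub_add_cancel]

theorem domDual_nonempty : pb.domDual.Nonempty := by
  choose π hπ hf using pb.fstar_dom
  exact ⟨π, fun i => ⟨hπ i, hf i⟩⟩

theorem objective_ne_bot {x : Vec n} (hx : x ∈ pb.domX) : pb.objective x ≠ ⊥ := by
  obtain ⟨π, hπ⟩ := pb.domDual_nonempty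
  obtain ⟨p, hp⟩ : pb.domP.Nonempty := pb.rhoStar_dom
  exact ne_bot_of_le_ne_bot (EReal.coe_ne_bot _) (pb.coe_saddle_le_objective hx hp hπ)

theorem objective_ne_top {x : Vec n} (hx : x ∈ pb.domX) : pb.objective x ≠ ⊤ := by
  obtain ⟨c, hc⟩ := pb.rhoStar_pcc.exists_lower_bound pb.isCompact_P
  refine ne_top_of_le_ne_top (EReal.coe_ne_top _) (pb.objective_le_of_saddle_le hx
    (K := ∑ i, |(pb.scenarioCost i x).toReal| - c + (pb.u x).toReal) fun p hp π hπ => ?_)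
  have h1 : c ≤ (pb.rhoStar p).toReal := by
    rw [← EReal.coe_le_coe_iff, pb.rhoStar_pcc.coe_toReal hp.2]; exact hc p hp.1
  have h2 : ∑ i, p i * (inner ℝ (pb.A i x) (π i) - (pb.fstar i (π i)).toReal)
      ≤ ∑ i, |(pb.scenarioCost i x).toReal| := by
    refine Finset.sum_le_sum fun i _ => ?_
    have h0 := (pb.P_subset hp.1).1 i
    have h01 : p i ≤ 1 := by
      rw [← (pb.P_subset hp.1).2]
      exact Finset.single_le_sum (fun j _ => (pb.P_subset hp.1).1 j) (Finset.mem_univ i)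
    calc _ ≤ p i * |(pb.scenarioCost i x).toReal| := mul_le_mul_of_nonneg_left
          ((pb.le_scenarioCost (hπ i).1 (hπ i).2).trans (le_abs_self _)) h0
      _ ≤ _ := mul_le_of_le_one_left (abs_nonneg _) h01
  rw [saddle]
  linarith

variable {pb} in
theorem IsOptimal.mem_domX {x : Vec n} (hx : pb.IsOptimal x) : x ∈ pb.domX := by
  refine ⟨hx.1, fun hu => ?_⟩
  obtain ⟨z, hz, hzu⟩ := pb.u_dom
  obtain ⟨p, hp, hρ⟩ := pb.rhoStar_dom
  have h1 := isMinOn_iff.1 hx.2 z hz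
  have h2 : pb.objective x = ⊤ := by
    rw [objective, hu]
    refine EReal.add_top_of_ne_bot (ne_bot_of_le_ne_bot ?_ (le_iSup₂_of_le
      (f := fun p (_ : p ∈ pb.P) => (∑ i, (p i : EReal) * pb.scenarioCost i x) - pb.rhoStar p)
      p hp le_rfl))
    rw [pb.sum_mul_scenarioCost, ← pb.rhoStar_pcc.coe_toReal hρ, ← EReal.coe_sub]
    exact EReal.coe_ne_bot _
  rw [h2, top_le_iff] at h1
  exact pb.objective_ne_top ⟨hz, hzu⟩ h1

theorem convexOn_saddle (p : Fin m → ℝ) (π : ∀ i, Vec (pb.k i)) :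
    ConvexOn ℝ pb.domX fun x => pb.saddle x p π := by
  have hu : ConvexOn ℝ pb.domX fun x => (pb.u x).toReal := pb.u_pcc.convexOn pb.convex_X
  refine ⟨hu.1, fun x hx y hy a b ha hb hab => ?_⟩
  have h := hu.2 hx hy ha hb hab
  have e : ∑ i, p i * (inner ℝ (pb.A i (a • x + b • y)) (π i) - (pb.fstar i (π i)).toReal)
      = a * ∑ i, p i * (inner ℝ (pb.A i x) (π i) - (pb.fstar i (π i)).toReal)
        + b * ∑ i, p i * (inner ℝ (pb.A i y) (π i) - (pb.fstar i (π i)).toReal) := by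
    rw [Finset.mul_sum, Finset.mul_sum, ← Finset.sum_add_distrib]
    refine Finset.sum_congr rfl fun i _ => ?_
    rw [map_add, map_smul, map_smul, inner_add_left, real_inner_smul_left, real_inner_smul_left]
    linear_combination (p i * (pb.fstar i (π i)).toReal) * hab
  simp only [saddle, e, smul_eq_mul] at h ⊢
  have e2 : (pb.rhoStar p).toReal = a * (pb.rhoStar p).toReal + b * (pb.rhoStar p).toReal := by
    rw [← add_mul, hab, one_mul]
  linarith

theorem objective_sub_le {x y : Vec n} (hx : x ∈ pb.domX) (hy : y ∈ pb.domX) {K : ℝ}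
    (h : ∀ p ∈ pb.domP, ∀ π ∈ pb.domDual, pb.saddle x p π - (pb.objective y).toReal ≤ K) :
    pb.objective x - pb.objective y ≤ (K : EReal) := by
  have e := EReal.coe_toReal (pb.objective_ne_top hy) (pb.objective_ne_bot hy)
  have h1 := pb.objective_le_of_saddle_le hx (K := K + (pb.objective y).toReal)
    fun p hp π hπ => by linarith [h p hp π hπ]
  rw [EReal.coe_add, e] at h1
  exact EReal.sub_le_of_le_add h1

theorem saddle_le_objective_toReal {x : Vec n} (hx : x ∈ pb.domX) {p : Fin m → ℝ}
    (hp : p ∈ pb.domP) {π : ∀ i, Vec (pb.k i)} (hπ : π ∈ pb.domDual) :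
    pb.saddle x p π ≤ (pb.objective x).toReal := by
  rw [← EReal.coe_le_coe_iff, EReal.coe_toReal (pb.objective_ne_top hx) (pb.objective_ne_bot hx)]
  exact pb.coe_saddle_le_objective hx hp hπ

theorem norm_A_le_MA (i : Fin m) : ‖pb.A i‖ ≤ pb.MA :=
  le_ciSup (f := fun i => ‖pb.A i‖) (Set.finite_range _).bddAbove i

theorem MA_nonneg : 0 ≤ pb.MA := Real.iSup_nonneg fun _ => norm_nonneg _

theorem DDual_nonneg : 0 ≤ pb.DDual := Real.iSup_nonneg fun _ => Metric.diam_nonneg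

theorem norm_sub_le_DDual {i : Fin m} {π π' : Vec (pb.k i)} (h : π ∈ pb.Dual i)
    (h' : π' ∈ pb.Dual i) : ‖π - π'‖ ≤ pb.DDual := by
  rw [← dist_eq_norm]
  exact (Metric.dist_le_diam_of_mem (pb.isBounded_Dual i) h h').trans
    (le_ciSup (f := fun i => Metric.diam (pb.Dual i)) (Set.finite_range _).bddAbove i)

theorem inner_A_le {i : Fin m} (x : Vec n) (π : Vec (pb.k i)) :
    inner ℝ (pb.A i x) π ≤ pb.MA * (‖x‖ * ‖π‖) := by
  calc inner ℝ (pb.A i x) π ≤ ‖pb.A i x‖ * ‖π‖ := real_inner_le_norm _ _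
    _ ≤ (‖pb.A i‖ * ‖x‖) * ‖π‖ := by gcongr; exact (pb.A i).le_opNorm x
    _ ≤ (pb.MA * ‖x‖) * ‖π‖ := by gcongr; exact pb.norm_A_le_MA i
    _ = _ := by ring

end Problem

/-- The pairing `∑ i, p i * ⟪v i, y⟫`. -/
def pair {n m : ℕ} (v : Fin m → Vec n) (p : Fin m → ℝ) (y : Vec n) : ℝ :=
  ∑ i, p i * inner ℝ (v i) y

/-! ### The bilinear pairing -/

section Pair

variable {n m : ℕ} (v : Fin m → Vec n) (p q : Fin m → ℝ) (y z : Vec n)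

theorem pair_sub_left : pair v (p - q) y = pair v p y - pair v q y := by
  simp [pair, sub_mul]

theorem pair_sub_right : pair v p (y - z) = pair v p y - pair v p z := by
  simp [pair, inner_sub_right, mul_sub]

theorem pair_smul_left (c : ℝ) : pair v (c • p) y = c * pair v p y := by
  simp [pair, Finset.mul_sum, mul_assoc]

theorem pair_smul_right (c : ℝ) : pair v p (c • y) = c * pair v p y := by
  simp only [pair, Finset.mul_sum, real_inner_smul_right]
  exact Finset.sum_congr rfl fun i _ => by ring

@[simp] theorem pair_zero_left : pair v 0 y = 0 := by simp [pair]

@[simp] theorem pair_zero_right : pair v p 0 = 0 := by simp [pair]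

theorem inner_sum_smul : inner ℝ y (∑ i, p i • v i) = pair v p y := by
  rw [inner_sum, pair]
  exact Finset.sum_congr rfl fun i _ => by rw [real_inner_smul_right, real_inner_comm]

end Pair

/-! ### Operator norm and radius of P -/

namespace ProxSetup

variable {m : ℕ} {P : Set (Fin m → ℝ)} (px : ProxSetup P)

/-- Equivalence of norms in finite dimension, by compactness of the unit sphere. It makes the sets
defining `opNorm` and `MTilde` bounded, without which their real `sSup` would carry no information.
-/
theorem exists_mul_norm_le : ∃ c : ℝ, 0 < c ∧ ∀ p, c * ‖p‖ ≤ px.normU p := by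
  have hcont : Continuous px.normU := by
    rw [← continuousOn_univ]
    exact px.normU.convexOn.continuousOn isOpen_univ
  obtain ⟨c, hc, h⟩ := (isCompact_sphere (0 : Fin m → ℝ) 1).exists_forall_le'
    (a := (0 : ℝ)) hcont.continuousOn (fun p hp => by
      refine lt_of_le_of_ne (apply_nonneg _ _) fun h0 => ?_
      rw [px.normU_eq_zero p h0.symm] at hp
      simp at hp)
  refine ⟨c, hc, fun p => ?_⟩
  by_cases hp : p = 0
  · simp [hp]
  have hn : 0 < ‖p‖ := norm_pos_iff.2 hp
  have h1 := h (‖p‖⁻¹ • p) (by simp [norm_smul, hn.ne'])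
  rw [map_smul_eq_mul, norm_inv, norm_norm, inv_mul_eq_div, le_div_iff₀ hn] at h1
  exact h1

theorem exists_pair_le : ∃ C : ℝ, 0 ≤ C ∧ ∀ {n : ℕ} (v : Fin m → Vec n) (p : Fin m → ℝ) (y : Vec n),
    px.normU p ≤ 1 → ‖y‖ ≤ 1 → pair v p y ≤ C * ∑ i, ‖v i‖ := by
  obtain ⟨c, hc, h⟩ := px.exists_mul_norm_le
  refine ⟨c⁻¹, by positivity, fun v p y hp hy => ?_⟩
  rw [pair, Finset.mul_sum]
  refine Finset.sum_le_sum fun i _ => (le_abs_self _).trans ?_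
  have h1 : ‖p‖ ≤ c⁻¹ := by
    rw [← one_div, le_div_iff₀ hc, mul_comm]; exact (h p).trans hp
  rw [abs_mul]
  have h2 : |inner ℝ (v i) y| ≤ ‖v i‖ :=
    (abs_real_inner_le_norm _ _).trans (mul_le_of_le_one_right (norm_nonneg _) hy)
  exact mul_le_mul ((norm_le_pi_norm p i).trans h1) h2 (abs_nonneg _) (by positivity)

theorem bddAbove_opNorm {n : ℕ} (v : Fin m → Vec n) :
    BddAbove {r : ℝ | ∃ p : Fin m → ℝ, ∃ y : Vec n, px.normU p ≤ 1 ∧ ‖y‖ ≤ 1 ∧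
      r = ∑ i, p i * inner ℝ (v i) y} := by
  obtain ⟨C, -, h⟩ := px.exists_pair_le
  refine ⟨C * ∑ i, ‖v i‖, ?_⟩
  rintro r ⟨p, y, hp, hy, rfl⟩
  exact h v p y hp hy

theorem opNorm_nonneg {n : ℕ} (v : Fin m → Vec n) : 0 ≤ px.opNorm v :=
  le_csSup (px.bddAbove_opNorm v) ⟨0, 0, by simp, by simp, by simp⟩

theorem pair_le {n : ℕ} (v : Fin m → Vec n) (p : Fin m → ℝ) (y : Vec n) :
    pair v p y ≤ px.opNorm v * (px.normU p * ‖y‖) := by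
  by_cases hp : px.normU p = 0
  · simp [px.normU_eq_zero p hp]
  by_cases hy : y = 0
  · simp [hy]
  have hp' : 0 < px.normU p := lt_of_le_of_ne (apply_nonneg _ _) (Ne.symm hp)
  have hy' : 0 < ‖y‖ := norm_pos_iff.2 hy
  have h : pair v ((px.normU p)⁻¹ • p) (‖y‖⁻¹ • y) ≤ px.opNorm v :=
    le_csSup (px.bddAbove_opNorm v) ⟨_, _, by
      rw [map_smul_eq_mul, Real.norm_of_nonneg (by positivity), inv_mul_cancel₀ hp'.ne'],
      by rw [norm_smul, norm_inv, norm_norm, inv_mul_cancel₀ hy'.ne'], rfl⟩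
  rw [pair_smul_left, pair_smul_right, ← mul_assoc, ← mul_inv, inv_mul_eq_div,
    div_le_iff₀ (by positivity)] at h
  exact h

theorem opNorm_le {n : ℕ} (v : Fin m → Vec n) {K : ℝ} (hK : 0 ≤ K)
    (h : ∀ p y, px.normU p ≤ 1 → ‖y‖ ≤ 1 → pair v p y ≤ K) : px.opNorm v ≤ K := by
  refine Real.sSup_le ?_ hK
  rintro r ⟨p, y, hp, hy, rfl⟩
  exact h p y hp hy

theorem DP_nonneg : 0 ≤ px.DP := by
  refine Real.sSup_nonneg ?_
  rintro r ⟨p, -, q, -, rfl⟩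
  positivity

theorem normU_sq_le_U {p q : Fin m → ℝ} (hp : p ∈ P) (hq : q ∈ P) :
    px.normU (p - q) ^ 2 / 2 ≤ px.U p q :=
  px.strongly_convex p hp q hq

theorem U_nonneg {p q : Fin m → ℝ} (hp : p ∈ P) (hq : q ∈ P) : 0 ≤ px.U p q :=
  le_trans (by positivity) (px.normU_sq_le_U hp hq)

theorem U_le {p q : Fin m → ℝ} (hp : p ∈ P) (hq : q ∈ P) : px.U p q ≤ px.DP ^ 2 / 2 := by
  have h : √(2 * px.U p q) ≤ px.DP := le_csSup px.bddAbove ⟨p, hp, q, hq, rfl⟩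
  have h2 := (Real.sqrt_le_left px.DP_nonneg).1 h
  linarith

/-- Settles the degenerate case `DP = 0`: all differences in P then have norm 0, so the cross terms
vanish although the stepsize quotients are 0. -/
theorem normU_sub_le_DP {p q : Fin m → ℝ} (hp : p ∈ P) (hq : q ∈ P) :
    px.normU (p - q) ≤ px.DP := by
  refine abs_le_of_sq_le_sq' ?_ px.DP_nonneg |>.2
  linarith [px.U_le hp hq, px.normU_sq_le_U hp hq]

end ProxSetup

/-! ### The uniform bound on the operator norms -/

section MTilde

variable {n m : ℕ} (pb : Problem n m) (px : ProxSetup pb.P)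

theorem opNorm_le_MTilde {π : ∀ i, Vec (pb.k i)} (hπ : ∀ i, π i ∈ pb.Dual i) :
    px.opNorm (pb.v π) ≤ MTilde pb px := by
  refine le_csSup ?_ ⟨π, hπ, rfl⟩
  obtain ⟨C, hC, h⟩ := px.exists_pair_le
  choose B hB using fun i => (pb.isBounded_Dual i).exists_norm_le
  have hle : ∀ π' : ∀ i, Vec (pb.k i), (∀ i, π' i ∈ pb.Dual i) →
      C * ∑ i, ‖pb.v π' i‖ ≤ C * ∑ i, ‖pb.A i‖ * B i := by
    intro π' hπ'
    refine mul_le_mul_of_nonneg_left (Finset.sum_le_sum fun i _ => ?_) hC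
    refine (ContinuousLinearMap.le_opNorm _ _).trans ?_
    rw [LinearIsometryEquiv.norm_map]
    exact mul_le_mul_of_nonneg_left (hB i _ (hπ' i)) (norm_nonneg _)
  refine ⟨C * ∑ i, ‖pb.A i‖ * B i, ?_⟩
  rintro r ⟨π', hπ', rfl⟩
  refine px.opNorm_le _ (le_trans (by positivity) (hle π' hπ')) fun p y hp hy => ?_
  exact (h _ p y hp hy).trans (hle π' hπ')

theorem MTilde_nonneg : 0 ≤ MTilde pb px := by
  refine Real.sSup_nonneg ?_
  rintro r ⟨π, -, rfl⟩
  exact px.opNorm_nonneg _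

theorem pair_v_eq (π : ∀ i, Vec (pb.k i)) (p : Fin m → ℝ) (x : Vec n) :
    pair (pb.v π) p x = ∑ i, p i * inner ℝ (pb.A i x) (π i) := by
  refine Finset.sum_congr rfl fun i _ => ?_
  rw [Problem.v, ContinuousLinearMap.adjoint_inner_left, real_inner_comm]

end MTilde

/-- Strong convexity with modulus `α ≥ 0` of the real-valued function `(φ ·).toReal` on the
segments between points at which `φ` is finite. -/
def SegmentConvex {E : Type*} [NormedAddCommGroup E] [NormedSpace ℝ E]
    (α : ℝ) (φ : E → EReal) : Prop :=
  ∀ x y : E, φ x ≠ ⊤ → φ y ≠ ⊤ → ∀ l : ℝ, 0 < l → l < 1 →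
    (φ ((1 - l) • x + l • y)).toReal + α / 2 * (1 - l) * l * ‖y - x‖ ^ 2
      ≤ (1 - l) * (φ x).toReal + l * (φ y).toReal

theorem StronglyConvex.segmentConvex {E : Type*} [NormedAddCommGroup E] [NormedSpace ℝ E]
    {α : ℝ} {φ : E → EReal} (hs : StronglyConvex α φ) (h : ProperClosedConvex φ) :
    SegmentConvex α φ :=
  fun _ _ hx hy _ hl0 hl1 => hs.toReal_segment h hx hy hl0 hl1

theorem ProperClosedConvex.segmentConvex {E : Type*} [NormedAddCommGroup E] [NormedSpace ℝ E]
    {φ : E → EReal} (h : ProperClosedConvex φ) : SegmentConvex 0 φ := by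
  intro x y hx hy l hl0 hl1
  have := (h.convexOn convex_univ).2 ⟨trivial, hx⟩ ⟨trivial, hy⟩ (by linarith : 0 ≤ 1 - l) hl0.le
    (by ring)
  simpa using this

theorem sum_Icc_add_le_of_telescope {F G : ℕ → ℝ} {G₀ : ℝ} {N : ℕ} (hN : 1 ≤ N)
    (h1 : F 1 + G 1 ≤ G₀) (hs : ∀ t, 2 ≤ t → t ≤ N → F t + G t ≤ G (t - 1)) :
    ∑ t ∈ Finset.Icc 1 N, F t + G N ≤ G₀ := by
  induction N, hN using Nat.le_induction with
  | base => simpa using h1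
  | succ N hN ih =>
    have h2 := ih fun t ht htN => hs t ht (by omega)
    have h3 := hs (N + 1) (by omega) le_rfl
    rw [Finset.sum_Icc_succ_top (by omega)]
    rw [Nat.add_sub_cancel] at h3
    linarith

theorem momentum_one {n m : ℕ} (v vPrev : Fin m → Vec n) (p : ℕ → Fin m → ℝ) (pPrev : Fin m → ℝ)
    (δ : ℕ → ℝ) (z : Vec n) :
    inner ℝ z (momentum v vPrev p pPrev δ 1)
      = pair v (p 0) z + δ 1 * pair vPrev (p 0 - pPrev) z := by
  rw [momentum, if_pos rfl, inner_add_right, real_inner_smul_right, inner_sum_smul]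
  congr 2
  exact inner_sum_smul vPrev (p 0 - pPrev) z

theorem momentum_of_two_le {n m : ℕ} (v vPrev : Fin m → Vec n) (p : ℕ → Fin m → ℝ)
    (pPrev : Fin m → ℝ) (δ : ℕ → ℝ) (z : Vec n) {s : ℕ} (hs : 2 ≤ s) :
    inner ℝ z (momentum v vPrev p pPrev δ s)
      = pair v (p (s - 1)) z + δ s * pair v (p (s - 1) - p (s - 2)) z := by
  rw [momentum, if_neg (by omega), inner_add_right, real_inner_smul_right, inner_sum_smul]
  congr 2
  exact inner_sum_smul v (p (s - 1) - p (s - 2)) z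

theorem Problem.saddle_eq {n m : ℕ} (pb : Problem n m) (x : Vec n) (p : Fin m → ℝ)
    (π : ∀ i, Vec (pb.k i)) :
    pb.saddle x p π = pair (pb.v π) p x - ∑ i, p i * (pb.fstar i (π i)).toReal
      - (pb.rhoStar p).toReal + (pb.u x).toReal := by
  rw [Problem.saddle, pair_v_eq, ← Finset.sum_sub_distrib]
  simp only [mul_sub]

/-! ### One iteration of the sliding subroutine -/

section Subroutine

variable {n m : ℕ} {pb : Problem n m} {px : ProxSetup pb.P}
  {xPrev : Vec n} {pPrev : Fin m → ℝ} {π : ∀ i, Vec (pb.k i)} {vPrev : Fin m → Vec n}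
  {η : ℝ} {δ γ β : ℕ → ℝ} {S : ℕ} {y : ℕ → Vec n} {p : ℕ → Fin m → ℝ}

theorem IsSPS.y_mem_domX
    (h : IsSPS pb px xPrev pPrev (pb.v π) vPrev (fun i => pb.fstar i (π i)) η δ γ β S y p)
    {s : ℕ} (h1 : 1 ≤ s) (hS : s ≤ S) : y s ∈ pb.domX :=
  ⟨h.y_mem s h1 hS, (pb.u_pcc.min_real pb.u_dom (h.y_min s h1 hS)).1⟩

/-- Regroups the objective as a real function minus `rhoStar`, the form that `max_real` accepts; the
conjugate values are finite since π lies in `domDual`. -/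
theorem IsSPS.p_isMaxOn
    (h : IsSPS pb px xPrev pPrev (pb.v π) vPrev (fun i => pb.fstar i (π i)) η δ γ β S y p)
    (hπ : π ∈ pb.domDual) {s : ℕ} (h1 : 1 ≤ s) (hS : s ≤ S) :
    IsMaxOn (fun r : Fin m → ℝ => ((pair (pb.v π) r (y s)
      - ∑ i, r i * (pb.fstar i (π i)).toReal - γ s * px.U r (p (s - 1)) : ℝ) : EReal)
        - pb.rhoStar r) pb.P (p s) := by
  convert h.p_max s h1 hS using 2 with r
  have e : ∑ i, (r i : EReal) * (((inner ℝ (pb.v π i) (y s) : ℝ) : EReal) - pb.fstar i (π i))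
      = ((pair (pb.v π) r (y s) - ∑ i, r i * (pb.fstar i (π i)).toReal : ℝ) : EReal) := by
    rw [pair, ← Finset.sum_sub_distrib, coe_sum]
    refine Finset.sum_congr rfl fun i _ => ?_
    rw [← mul_sub, EReal.coe_mul, EReal.coe_sub, (pb.fstar_pcc i).coe_toReal (hπ i).2]
  have comm : ∀ (a b : ℝ) (c : EReal), ((a - b : ℝ) : EReal) - c = (a : EReal) - c - (b : EReal) := by
    intro a b c
    rw [EReal.coe_sub]
    simp only [sub_eq_add_neg]
    rw [add_right_comm]
  rw [e, comm]

theorem IsSPS.p_mem_domP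
    (h : IsSPS pb px xPrev pPrev (pb.v π) vPrev (fun i => pb.fstar i (π i)) η δ γ β S y p)
    (hπ : π ∈ pb.domDual) {s : ℕ} (h1 : 1 ≤ s) (hS : s ≤ S) : p s ∈ pb.domP :=
  ⟨h.p_mem s h1 hS, (pb.rhoStar_pcc.max_real pb.rhoStar_dom (h.p_isMaxOn hπ h1 hS)).1⟩

/-- The inequality produced by one inner iteration of the sliding subroutine. -/
theorem IsSPS.step
    (h : IsSPS pb px xPrev pPrev (pb.v π) vPrev (fun i => pb.fstar i (π i)) η δ γ β S y p)
    (hπ : π ∈ pb.domDual) {α : ℝ} (hα : SegmentConvex α pb.u) {s : ℕ} (h1 : 1 ≤ s) (hS : s ≤ S)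
    {w : Fin m → Vec n} {d : Fin m → ℝ}
    (hmom : ∀ z, inner ℝ z (momentum (pb.v π) vPrev p pPrev δ s)
      = pair (pb.v π) (p (s - 1)) z + δ s * pair w d z)
    {r : Fin m → ℝ} (hr : r ∈ pb.domP) {xs : Vec n} (hx : xs ∈ pb.domX) :
    pb.saddle (y s) r π - pb.saddle xs (p s) π
      ≤ pair (pb.v π) (p s - p (s - 1)) (y s - xs)
        - δ s * pair w d (y (s - 1) - xs) + δ s * pair w d (y (s - 1) - y s)
        + γ s * (px.U r (p (s - 1)) - px.U r (p s) - px.U (p s) (p (s - 1)))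
        + β s / 2 * (‖xs - y (s - 1)‖ ^ 2 - ‖y s - y (s - 1)‖ ^ 2 - ‖xs - y s‖ ^ 2)
        + η / 2 * (‖xs - xPrev‖ ^ 2 - ‖y s - xPrev‖ ^ 2 - ‖xs - y s‖ ^ 2)
        - α / 2 * ‖xs - y s‖ ^ 2 := by
  have hy := h.y_mem_domX h1 hS
  have hp := h.p_mem_domP hπ h1 hS
  have hymin := (pb.u_pcc.min_real pb.u_dom (h.y_min s h1 hS)).2
  have hpmax := (pb.rhoStar_pcc.max_real pb.rhoStar_dom (h.p_isMaxOn hπ h1 hS)).2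
  have hcX := pb.u_pcc.convexOn pb.convex_X
  have hcP := pb.rhoStar_pcc.convexOn pb.convex_P
  have hY := prox_growth (φ := fun x => (pb.u x).toReal) (y := y s) (z := xs)
    (v := momentum (pb.v π) vPrev p pPrev δ s) (a := y (s - 1)) (b := xPrev) (α := α)
    (β := β s) (η := η) (fun l hl0 hl1 => hα _ _ hy.2 hx.2 l hl0 hl1)
    (fun l hl0 hl1 => by
      have hm := hcX.1 hy hx (by linarith : 0 ≤ 1 - l) hl0.le (by ring)
      exact hymin _ hm.1 hm.2)
  have hPp := bregman_prox (ω := px.ω) (γ := γ s) (p := p s) (p' := p (s - 1)) (z := r)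
    (ψ := fun r => pair (pb.v π) r (y s) - ∑ i, r i * (pb.fstar i (π i)).toReal
      - (pb.rhoStar r).toReal) pb.convex_P px.differentiableOn hp.1 hr.1
    (fun l hl0 hl1 => by
      have hm := hcP.2 hp hr (by linarith : 0 ≤ 1 - l) hl0.le (by ring)
      have e : ∀ c : Fin m → ℝ, ∑ i, ((1 - l) • p s + l • r) i * c i
          = (1 - l) * ∑ i, p s i * c i + l * ∑ i, r i * c i := by
        intro c
        rw [Finset.mul_sum, Finset.mul_sum, ← Finset.sum_add_distrib]
        refine Finset.sum_congr rfl fun i _ => ?_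
        simp only [Pi.add_apply, Pi.smul_apply, smul_eq_mul]
        ring
      simp only [smul_eq_mul] at hm
      simp only [pair, e]
      linarith)
    (fun l hl0 hl1 => by
      have hm := hcP.1 hp hr (by linarith : 0 ≤ 1 - l) hl0.le (by ring)
      have := hpmax _ hm.1 hm.2
      simp only [ProxSetup.U] at this
      linarith)
  -- The y step is priced at p^{s-1}, whereas the gap involves p^s. Adding the two prox inequalities
  -- leaves the pairing of p^s - p^{s-1} with y^s - xs, against which the momentum term is set. The
  -- generic w and d cover both s = 1 and s ≥ 2.
  simp only [hmom] at hY
  simp only [Problem.saddle_eq, pair_sub_left, pair_sub_right, ProxSetup.U] at hPp ⊢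
  linarith

end Subroutine

/-- The weight `w t / S t` of an inner iteration of phase `t`. -/
def Stepsizes.innerWeight (st : Stepsizes) (t : ℕ) : ℝ := st.w t / st.S t

/-- Conditions on the stepsizes under which the method converges; `T` and `Γ` are the constant
values of `w t * τ t` and `innerWeight t * γ t s`. -/
structure StepsizeConditions {n m : ℕ} (pb : Problem n m) (px : ProxSetup pb.P) (st : Stepsizes)
    (M : ℕ → ℝ) (N : ℕ) (α T Γ : ℝ) : Prop where
  α_nonneg : 0 ≤ α
  w_pos : ∀ t, 1 ≤ t → 0 < st.w t
  S_pos : ∀ t, 1 ≤ st.S t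
  q_eq_one : ∀ t s, st.q t s = 1
  η_nonneg : ∀ t, 0 ≤ st.η t
  Γ_nonneg : 0 ≤ Γ
  w_mul_θ : ∀ t, 2 ≤ t → st.w t * st.θ t = st.w (t - 1)
  w_mul_τ : ∀ t, 1 ≤ t → st.w t * st.τ t = T
  dual_cross : ∀ t, 1 ≤ t → ∀ i, ∀ π ∈ pb.Dual i, ∀ π' ∈ pb.Dual i, ∀ a : ℝ,
    st.w t * (pb.MA * (a * ‖π - π'‖)) ≤ T / 2 * ‖π - π'‖ ^ 2 + st.w t * st.η t / 2 * a ^ 2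
  η_step : ∀ t, 2 ≤ t → st.w t * st.η t ≤ st.w (t - 1) * (st.η (t - 1) + α / 2)
  δ_first : ∀ t, 2 ≤ t → st.innerWeight t * st.δ t 1 = st.innerWeight (t - 1)
  δ_inner : ∀ t s, 2 ≤ s → st.δ t s = 1
  γ_eq : ∀ t s, 1 ≤ t → st.innerWeight t * st.γ t s = Γ
  β_inner : ∀ t s, 1 ≤ t → 2 ≤ s → st.β t s ≤ st.β t (s - 1) + α / 2
  β_first : ∀ t, 2 ≤ t → st.innerWeight t * st.β t 1
    ≤ st.innerWeight (t - 1) * (st.β (t - 1) (st.S (t - 1)) + α / 2)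
  cross_inner : ∀ t s, 1 ≤ t → t ≤ N → 2 ≤ s → ∀ p ∈ pb.P, ∀ p' ∈ pb.P, ∀ b : ℝ,
    st.innerWeight t * (M t * (px.normU (p - p') * b))
      ≤ st.innerWeight t * st.β t s / 2 * b ^ 2 + Γ / 2 * px.normU (p - p') ^ 2
  cross_first : ∀ t, 2 ≤ t → t ≤ N → ∀ p ∈ pb.P, ∀ p' ∈ pb.P, ∀ b : ℝ,
    st.innerWeight (t - 1) * (M (t - 1) * (px.normU (p - p') * b))
      ≤ st.innerWeight t * st.β t 1 / 2 * b ^ 2 + Γ / 2 * px.normU (p - p') ^ 2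
  cross_last : ∀ t, 1 ≤ t → t ≤ N → ∀ p ∈ pb.P, ∀ p' ∈ pb.P, ∀ b : ℝ,
    st.innerWeight t * (M t * (px.normU (p - p') * b))
      ≤ st.innerWeight t * (st.β t (st.S t) + α / 2) / 2 * b ^ 2
        + Γ / 2 * px.normU (p - p') ^ 2

/-! ### Dual prox steps, membership of the iterates, Jensen's inequality -/

namespace IsDRAOS

variable {n m : ℕ} {pb : Problem n m} {px : ProxSetup pb.P} {st : Stepsizes} {N : ℕ}
  {it : Iterates pb}

theorem dual_prox (h : IsDRAOS pb px st N it) {t : ℕ} (h1 : 1 ≤ t) (hN : t ≤ N) (i : Fin m) :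
    pb.fstar i (it.dual t i) ≠ ⊤ ∧ ∀ π ∈ pb.Dual i, pb.fstar i π ≠ ⊤ →
      inner ℝ (pb.A i (it.x (t - 1) + st.θ t • (it.x (t - 1) - it.x (t - 2)))) (π - it.dual t i)
        - (pb.fstar i π).toReal + (pb.fstar i (it.dual t i)).toReal
      ≤ st.τ t / 2 * (‖π - it.dual (t - 1) i‖ ^ 2 - ‖it.dual t i - it.dual (t - 1) i‖ ^ 2
          - ‖π - it.dual t i‖ ^ 2) := by
  have hmax := (pb.fstar_pcc i).max_real (pb.fstar_dom i) (h.dual_max t h1 hN i)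
  refine ⟨hmax.1, fun π hπ hf => ?_⟩
  have hc := (pb.fstar_pcc i).convexOn (pb.convex_Dual i)
  set a := pb.A i (it.x (t - 1) + st.θ t • (it.x (t - 1) - it.x (t - 2)))
  have hm := h.dual_mem t h1 hN i
  have hY := prox_growth (φ := fun x => (pb.fstar i x).toReal) (y := it.dual t i) (z := π)
    -- Maximization is turned into minimization by the sign of a; the second prox term is switched
    -- off by η = 0, so its center is arbitrary.
    (v := -a) (a := it.dual (t - 1) i) (b := 0) (α := 0) (β := st.τ t) (η := 0)
    (fun l hl0 hl1 => (pb.fstar_pcc i).segmentConvex _ _ hmax.1 hf l hl0 hl1)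
    (fun l hl0 hl1 => by
      have hm' := hc.1 ⟨hm, hmax.1⟩ ⟨hπ, hf⟩ (by linarith : 0 ≤ 1 - l) hl0.le (by ring)
      have := hmax.2 _ hm'.1 hm'.2
      rw [inner_neg_right, inner_neg_right, real_inner_comm a (it.dual t i),
        real_inner_comm a (_ + _)]
      linarith)
  rw [inner_neg_right, inner_neg_right, real_inner_comm a (it.dual t i), real_inner_comm a π] at hY
  rw [inner_sub_right]
  linarith

theorem dual_mem_domDual (h : IsDRAOS pb px st N it) {t : ℕ} (h1 : 1 ≤ t) (hN : t ≤ N) :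
    it.dual t ∈ pb.domDual :=
  fun i => ⟨h.dual_mem t h1 hN i, (h.dual_prox h1 hN i).1⟩

theorem y_mem_domX (h : IsDRAOS pb px st N it) {t s : ℕ} (h1 : 1 ≤ t) (hN : t ≤ N) (hs : 1 ≤ s)
    (hS : s ≤ st.S t) : it.y t s ∈ pb.domX :=
  (h.sps t h1 hN).y_mem_domX hs hS

theorem p_mem_domP (h : IsDRAOS pb px st N it) {t s : ℕ} (h1 : 1 ≤ t) (hN : t ≤ N) (hs : 1 ≤ s)
    (hS : s ≤ st.S t) : it.p t s ∈ pb.domP :=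
  (h.sps t h1 hN).p_mem_domP (h.dual_mem_domDual h1 hN) hs hS

/-- Unlike `p_mem_domP` this includes s = 0: the initial p belongs to P, but `rhoStar` may be
infinite there. -/
theorem p_mem_P (h : IsDRAOS pb px st N it) (hSp : ∀ t, 1 ≤ st.S t) {t s : ℕ} (h1 : 1 ≤ t)
    (hN : t ≤ N) (hS : s ≤ st.S t) : it.p t s ∈ pb.P := by
  rcases Nat.eq_zero_or_pos s with rfl | hs
  · rcases Nat.lt_or_ge t 2 with ht | ht
    · obtain rfl : t = 1 := by omega
      exact h.p_init
    · rw [h.p_next t ht hN]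
      exact (h.p_mem_domP (by omega) (by omega) (hSp _) le_rfl).1
  · exact (h.p_mem_domP h1 hN hs hS).1

theorem x_eq_centerMass (h : IsDRAOS pb px st N it) {t : ℕ} (h1 : 1 ≤ t) (hN : t ≤ N) :
    it.x t = (Finset.Icc 1 (st.S t)).centerMass (st.q t) (it.y t) :=
  h.x_next t h1 hN

theorem sum_q_eq (hq : ∀ t s, st.q t s = 1) (t : ℕ) :
    ∑ s ∈ Finset.Icc 1 (st.S t), st.q t s = st.S t := by
  simp [hq]

theorem x_mem_domX (h : IsDRAOS pb px st N it) (hSp : ∀ t, 1 ≤ st.S t) (hq : ∀ t s, st.q t s = 1)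
    {t : ℕ} (h1 : 1 ≤ t) (hN : t ≤ N) : it.x t ∈ pb.domX := by
  rw [h.x_eq_centerMass h1 hN]
  refine (pb.u_pcc.convexOn pb.convex_X).1.centerMass_mem (fun s _ => by simp [hq]) ?_ ?_
  · rw [sum_q_eq hq]; exact_mod_cast hSp t
  · intro s hs
    rw [Finset.mem_Icc] at hs
    exact h.y_mem_domX h1 hN hs.1 hs.2

theorem map_x_le (h : IsDRAOS pb px st N it) (hSp : ∀ t, 1 ≤ st.S t) (hq : ∀ t s, st.q t s = 1)
    {t : ℕ} (h1 : 1 ≤ t) (hN : t ≤ N) (hw : 0 ≤ st.w t) {g : Vec n → ℝ}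
    (hg : ConvexOn ℝ pb.domX g) :
    st.w t * g (it.x t) ≤ ∑ s ∈ Finset.Icc 1 (st.S t), st.innerWeight t * g (it.y t s) := by
  have hS : (0 : ℝ) < st.S t := by exact_mod_cast hSp t
  have := hg.map_centerMass_le (t := Finset.Icc 1 (st.S t)) (w := st.q t) (p := it.y t)
    (fun s _ => by simp [hq]) (by rw [sum_q_eq hq]; exact hS)
    (fun s hs => by
      rw [Finset.mem_Icc] at hs
      exact h.y_mem_domX h1 hN hs.1 hs.2)
  rw [← h.x_eq_centerMass h1 hN, Finset.centerMass, sum_q_eq hq] at this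
  simp only [hq, one_mul, Function.comp_apply, smul_eq_mul] at this
  rw [← Finset.mul_sum, Stepsizes.innerWeight, div_eq_mul_inv, mul_assoc]
  exact mul_le_mul_of_nonneg_left this hw

theorem average_mem_domX (h : IsDRAOS pb px st N it) (hSp : ∀ t, 1 ≤ st.S t)
    (hq : ∀ t s, st.q t s = 1) (hw : ∀ t, 1 ≤ t → 0 < st.w t) (hN : 1 ≤ N) :
    it.average st N ∈ pb.domX := by
  change (Finset.Icc 1 N).centerMass st.w it.x ∈ _
  refine (pb.u_pcc.convexOn pb.convex_X).1.centerMass_mem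
    (fun t ht => (hw t (Finset.mem_Icc.1 ht).1).le)
    (Finset.sum_pos (fun t ht => hw t (Finset.mem_Icc.1 ht).1) ⟨1, by simp [hN]⟩) fun t ht => ?_
  rw [Finset.mem_Icc] at ht
  exact h.x_mem_domX hSp hq ht.1 ht.2

theorem map_average_le (h : IsDRAOS pb px st N it) (hSp : ∀ t, 1 ≤ st.S t)
    (hq : ∀ t s, st.q t s = 1) (hw : ∀ t, 1 ≤ t → 0 < st.w t) (hN : 1 ≤ N) {g : Vec n → ℝ}
    (hg : ConvexOn ℝ pb.domX g) :
    (∑ t ∈ Finset.Icc 1 N, st.w t) * g (it.average st N)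
      ≤ ∑ t ∈ Finset.Icc 1 N, st.w t * g (it.x t) := by
  have hW : 0 < ∑ t ∈ Finset.Icc 1 N, st.w t :=
    Finset.sum_pos (fun t ht => hw t (Finset.mem_Icc.1 ht).1) ⟨1, by simp [hN]⟩
  have := hg.map_centerMass_le (t := Finset.Icc 1 N) (w := st.w) (p := it.x)
    (fun t ht => (hw t (Finset.mem_Icc.1 ht).1).le) hW
    (fun t ht => by
      rw [Finset.mem_Icc] at ht
      exact h.x_mem_domX hSp hq ht.1 ht.2)
  rw [Finset.centerMass.eq_1 _ _ (g ∘ it.x), smul_eq_mul, inv_mul_eq_div, le_div_iff₀ hW, mul_comm] at this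
  exact this

end IsDRAOS

/-! ### Potential functions -/

section Potentials

variable {n m : ℕ} {pb : Problem n m} (px : ProxSetup pb.P) (st : Stepsizes)
  (it : Iterates pb) (α T Γ : ℝ) (r : Fin m → ℝ) (π : ∀ i, Vec (pb.k i)) (xs : Vec n)

/-- The potential of the inner iterations. -/
def innerPotential (t s : ℕ) : ℝ :=
  Γ * px.U r (it.p t s) + st.innerWeight t * (st.β t s + α / 2) / 2 * ‖xs - it.y t s‖ ^ 2
    - st.innerWeight t * pair (pb.v (it.dual t)) (it.p t s - it.p t (s - 1)) (it.y t s - xs)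
    + Γ / 2 * px.normU (it.p t s - it.p t (s - 1)) ^ 2

/-- The progress of an inner iteration, net of the terms controlled by the outer prox term. -/
def innerProgress (t s : ℕ) : ℝ :=
  pb.saddle (it.y t s) r (it.dual t) - pb.saddle xs (it.p t s) (it.dual t)
    - st.η t / 2 * (‖xs - it.x (t - 1)‖ ^ 2 - ‖it.y t s - it.x (t - 1)‖ ^ 2
        - ‖xs - it.y t s‖ ^ 2) + α / 4 * ‖xs - it.y t s‖ ^ 2

/-- The potential of the dual updates of scenario `i`. -/
def dualPotential (i : Fin m) (t : ℕ) : ℝ :=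
  T / 2 * ‖π i - it.dual t i‖ ^ 2
    - st.w t * inner ℝ (pb.A i (it.x t - it.x (t - 1))) (π i - it.dual t i)
    + st.w t * st.η t / 2 * ‖it.x t - it.x (t - 1)‖ ^ 2

/-- The potential of the phases. -/
def outerPotential (t : ℕ) : ℝ :=
  innerPotential px st it α Γ r xs t (st.S t) + ∑ i, r i * dualPotential st it T π i t
    + st.w t * (st.η t + α / 2) / 2 * ‖xs - it.x t‖ ^ 2

end Potentials

/-! ### Descent of the potentials over iterations and phases -/

section Descent

variable {n m : ℕ} {pb : Problem n m} {px : ProxSetup pb.P} {st : Stepsizes} {N : ℕ}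
  {it : Iterates pb} {α T Γ : ℝ} {r : Fin m → ℝ} {π : ∀ i, Vec (pb.k i)} {xs : Vec n}

theorem StepsizeConditions.innerWeight_pos {M : ℕ → ℝ} (hc : StepsizeConditions pb px st M N α T Γ)
    {t : ℕ} (h1 : 1 ≤ t) : 0 < st.innerWeight t :=
  div_pos (hc.w_pos t h1) (by exact_mod_cast hc.S_pos t)

/-- `IsSPS.step` times the inner weight. By strong convexity of ω, the leftover term -Γ U(p^s;
p^{s-1}) pays for the squared increment of p stored in the potential, to be spent on the next
momentum error. The final bracket is the present momentum error, not yet absorbed. -/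
theorem inner_step_aux (hc : StepsizeConditions pb px st (it.M px) N α T Γ)
    (h : IsDRAOS pb px st N it) (hα : SegmentConvex α pb.u) (hr : r ∈ pb.domP)
    (hx : xs ∈ pb.domX) {t s : ℕ} (h1 : 1 ≤ t) (hN : t ≤ N) (hs : 1 ≤ s) (hS : s ≤ st.S t)
    {w : Fin m → Vec n} {d : Fin m → ℝ}
    (hmom : ∀ z, inner ℝ z (momentum (pb.v (it.dual t))
        (if t = 1 then pb.v (it.dual 1) else pb.v (it.dual (t - 1))) (it.p t)
        (if t = 1 then it.p 1 0 else it.p (t - 1) (st.S (t - 1) - 1)) (st.δ t) s)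
      = pair (pb.v (it.dual t)) (it.p t (s - 1)) z + st.δ t s * pair w d z) :
    st.innerWeight t * innerProgress st it α r xs t s + innerPotential px st it α Γ r xs t s
      ≤ Γ * px.U r (it.p t (s - 1))
        + st.innerWeight t * st.β t s / 2 * ‖xs - it.y t (s - 1)‖ ^ 2
        - st.innerWeight t * st.δ t s * pair w d (it.y t (s - 1) - xs)
        + (st.innerWeight t * st.δ t s * pair w d (it.y t (s - 1) - it.y t s)
          - st.innerWeight t * st.β t s / 2 * ‖it.y t (s - 1) - it.y t s‖ ^ 2) := by
  have hstep := (h.sps t h1 hN).step (h.dual_mem_domDual h1 hN) hα hs hS hmom hr hx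
  have hω := hc.innerWeight_pos h1
  have hmul := mul_le_mul_of_nonneg_left hstep hω.le
  have hU := mul_le_mul_of_nonneg_left (px.normU_sq_le_U (h.p_mem_P hc.S_pos h1 hN hS)
    (h.p_mem_P hc.S_pos h1 hN (show s - 1 ≤ st.S t by omega))) hc.Γ_nonneg
  have hγ := hc.γ_eq t s h1
  rw [norm_sub_rev (it.y t s) (it.y t (s - 1))] at hmul
  rw [innerPotential, innerProgress]
  generalize px.U r (it.p t (s - 1)) = a1 at *
  generalize px.U r (it.p t s) = a2 at *
  generalize px.U (it.p t s) (it.p t (s - 1)) = a3 at *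
  have hγ' : st.innerWeight t * (st.γ t s * (a1 - a2 - a3)) = Γ * (a1 - a2 - a3) := by
    rw [← hγ]; ring
  linarith

theorem inner_step (hc : StepsizeConditions pb px st (it.M px) N α T Γ)
    (h : IsDRAOS pb px st N it) (hα : SegmentConvex α pb.u) (hr : r ∈ pb.domP)
    (hx : xs ∈ pb.domX) {t s : ℕ} (h1 : 1 ≤ t) (hN : t ≤ N) (hs : 2 ≤ s) (hS : s ≤ st.S t) :
    st.innerWeight t * innerProgress st it α r xs t s + innerPotential px st it α Γ r xs t s
      ≤ innerPotential px st it α Γ r xs t (s - 1) := by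
  refine (inner_step_aux hc h hα hr hx h1 hN (by omega) hS
    fun z => momentum_of_two_le _ _ _ _ _ z hs).trans ?_
  have hω := hc.innerWeight_pos h1
  have hp := px.pair_le (pb.v (it.dual t)) (it.p t (s - 1) - it.p t (s - 2))
    (it.y t (s - 1) - it.y t s)
  have hcr := hc.cross_inner t s h1 hN hs _ (h.p_mem_P hc.S_pos h1 hN (show s - 1 ≤ st.S t by omega))
    _ (h.p_mem_P hc.S_pos h1 hN (show s - 2 ≤ st.S t by omega)) ‖it.y t (s - 1) - it.y t s‖
  have hp2 := (mul_le_mul_of_nonneg_left hp hω.le).trans hcr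
  have hβ := mul_le_mul_of_nonneg_left (hc.β_inner t s h1 hs) hω.le
  have hβ2 := mul_le_mul_of_nonneg_right hβ (sq_nonneg ‖xs - it.y t (s - 1)‖)
  rw [innerPotential, hc.δ_inner t s hs, show s - 1 - 1 = s - 2 by omega]
  linarith

theorem first_step (hc : StepsizeConditions pb px st (it.M px) N α T Γ)
    (h : IsDRAOS pb px st N it) (hα : SegmentConvex α pb.u) (hr : r ∈ pb.domP)
    (hx : xs ∈ pb.domX) {t : ℕ} (h1 : 2 ≤ t) (hN : t ≤ N) :
    st.innerWeight t * innerProgress st it α r xs t 1 + innerPotential px st it α Γ r xs t 1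
      ≤ innerPotential px st it α Γ r xs (t - 1) (st.S (t - 1)) := by
  refine (inner_step_aux hc h hα hr hx (by omega) hN le_rfl (hc.S_pos t)
    fun z => momentum_one _ _ _ _ _ z).trans ?_
  have hω := hc.innerWeight_pos (show 1 ≤ t - 1 by omega)
  rw [if_neg (by omega), if_neg (by omega), hc.δ_first t h1, Nat.sub_self, h.p_next t h1 hN,
    h.y_next t h1 hN]
  set S := st.S (t - 1) with hSdef
  have hp := px.pair_le (pb.v (it.dual (t - 1))) (it.p (t - 1) S - it.p (t - 1) (S - 1))
    (it.y (t - 1) S - it.y t 1)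
  have hcr := hc.cross_first t h1 hN _
    (h.p_mem_P hc.S_pos (show 1 ≤ t - 1 by omega) (by omega) (le_refl S))
    _ (h.p_mem_P hc.S_pos (show 1 ≤ t - 1 by omega) (by omega) (show S - 1 ≤ S by omega))
    ‖it.y (t - 1) S - it.y t 1‖
  have hp2 := (mul_le_mul_of_nonneg_left hp hω.le).trans hcr
  have hβ := mul_le_mul_of_nonneg_right (hc.β_first t h1) (sq_nonneg ‖xs - it.y (t - 1) S‖)
  rw [innerPotential]
  linarith

/-- The two initial points in P coincide, so there is no momentum error; β_1^1 ≥ 0 allows the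
displacement of y to be dropped. -/
theorem initial_step (hc : StepsizeConditions pb px st (it.M px) N α T Γ)
    (h : IsDRAOS pb px st N it) (hα : SegmentConvex α pb.u) (hr : r ∈ pb.domP)
    (hx : xs ∈ pb.domX) (hN : 1 ≤ N) (hβ : 0 ≤ st.β 1 1) :
    st.innerWeight 1 * innerProgress st it α r xs 1 1 + innerPotential px st it α Γ r xs 1 1
      ≤ Γ * px.U r (it.p 1 0) + st.innerWeight 1 * st.β 1 1 / 2 * ‖xs - it.x 0‖ ^ 2 := by
  refine (inner_step_aux hc h hα hr hx le_rfl hN le_rfl (hc.S_pos 1)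
    fun z => momentum_one _ _ _ _ _ z).trans ?_
  have hω := hc.innerWeight_pos (le_refl 1)
  have : 0 ≤ st.innerWeight 1 * st.β 1 1 / 2 * ‖it.y 1 0 - it.y 1 1‖ ^ 2 := by positivity
  simp only [if_true, sub_self, pair_zero_left, Nat.sub_self]
  rw [h.y_init] at *
  linarith

theorem sum_innerProgress_le (hc : StepsizeConditions pb px st (it.M px) N α T Γ)
    (h : IsDRAOS pb px st N it) (hα : SegmentConvex α pb.u) (hr : r ∈ pb.domP)
    (hx : xs ∈ pb.domX) {t : ℕ} (h1 : 1 ≤ t) (hN : t ≤ N) {V : ℝ}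
    (hV : st.innerWeight t * innerProgress st it α r xs t 1 + innerPotential px st it α Γ r xs t 1
      ≤ V) :
    ∑ s ∈ Finset.Icc 1 (st.S t), st.innerWeight t * innerProgress st it α r xs t s
      + innerPotential px st it α Γ r xs t (st.S t) ≤ V :=
  sum_Icc_add_le_of_telescope (G := innerPotential px st it α Γ r xs t) (hc.S_pos t) hV
    fun _ hs hS => inner_step hc h hα hr hx h1 hN hs hS

theorem convexOn_norm_sub_sq {E : Type*} [NormedAddCommGroup E] [InnerProductSpace ℝ E] {s : Set E}
    (hs : Convex ℝ s) (a : E) : ConvexOn ℝ s fun z => ‖z - a‖ ^ 2 := by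
  refine ⟨hs, fun x _ y _ c d hc hd hcd => ?_⟩
  obtain rfl : c = 1 - d := by linarith
  simp only [smul_eq_mul]
  rw [norm_segment_sub_sq]
  have : 0 ≤ d * (1 - d) * ‖y - x‖ ^ 2 := by positivity
  linarith

/-- The total progress of the inner iterations bounds the progress of the phase. -/
theorem phase_progress_le (hc : StepsizeConditions pb px st (it.M px) N α T Γ)
    (h : IsDRAOS pb px st N it) (hx : xs ∈ pb.domX) {t : ℕ} (h1 : 1 ≤ t) (hN : t ≤ N) :
    st.w t * (pb.saddle (it.x t) r (it.dual t) - (pb.objective xs).toReal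
      - st.η t / 2 * (‖xs - it.x (t - 1)‖ ^ 2 - ‖it.x t - it.x (t - 1)‖ ^ 2
        - ‖xs - it.x t‖ ^ 2) + α / 4 * ‖xs - it.x t‖ ^ 2)
      ≤ ∑ s ∈ Finset.Icc 1 (st.S t), st.innerWeight t * innerProgress st it α r xs t s := by
  have hω := hc.innerWeight_pos h1
  have hcX := (pb.u_pcc.convexOn pb.convex_X).1
  have hη := hc.η_nonneg t
  have hα := hc.α_nonneg
  have hg : ConvexOn ℝ pb.domX fun z => pb.saddle z r (it.dual t)
      + (st.η t / 2 * ‖z - it.x (t - 1)‖ ^ 2 + (st.η t / 2 + α / 4) * ‖z - xs‖ ^ 2) := by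
    -- All terms that depend on y have nonnegative quadratic coefficients, so one application of
    -- Jensen moves them together to x^t.
    refine (pb.convexOn_saddle r (it.dual t)).add (ConvexOn.add ?_ ?_)
    · exact (convexOn_norm_sub_sq hcX (it.x (t - 1))).smul (by positivity)
    · exact (convexOn_norm_sub_sq hcX xs).smul (by positivity)
  have hJ := h.map_x_le hc.S_pos hc.q_eq_one h1 hN (hc.w_pos t h1).le hg
  set C := (pb.objective xs).toReal + st.η t / 2 * ‖xs - it.x (t - 1)‖ ^ 2 with hC
  have hsum : ∑ s ∈ Finset.Icc 1 (st.S t), (st.innerWeight t * (pb.saddle (it.y t s) r (it.dual t)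
      + (st.η t / 2 * ‖it.y t s - it.x (t - 1)‖ ^ 2
        + (st.η t / 2 + α / 4) * ‖it.y t s - xs‖ ^ 2)) - st.innerWeight t * C)
      ≤ ∑ s ∈ Finset.Icc 1 (st.S t), st.innerWeight t * innerProgress st it α r xs t s := by
    refine Finset.sum_le_sum fun s hs => ?_
    rw [Finset.mem_Icc] at hs
    have hle := pb.saddle_le_objective_toReal hx (h.p_mem_domP h1 hN hs.1 hs.2)
      (h.dual_mem_domDual h1 hN)
    rw [← mul_sub]
    refine mul_le_mul_of_nonneg_left ?_ hω.le
    rw [innerProgress, hC, norm_sub_rev (it.y t s) xs]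
    linarith
  have hS : (0 : ℝ) < st.S t := by exact_mod_cast hc.S_pos t
  have hcard : ∑ _s ∈ Finset.Icc 1 (st.S t), st.innerWeight t * C = st.w t * C := by
    rw [Finset.sum_const, Nat.card_Icc, Nat.add_sub_cancel, nsmul_eq_mul, Stepsizes.innerWeight]
    field_simp
  rw [Finset.sum_sub_distrib, hcard] at hsum
  refine le_trans (le_of_eq ?_) ((sub_le_sub_right hJ _).trans hsum)
  rw [hC, norm_sub_rev (it.x t) xs]
  ring

/-- The extrapolated point replaces x^t, and since w_t θ_t = w_{t-1} the errors telescope up to a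
product of increments of x and of π_i. The subtracted ‖x^t - x^{t-1}‖² is borrowed from the outer
prox term and stored in the potential to pay for that product in the next phase. -/
theorem dual_step (hc : StepsizeConditions pb px st (it.M px) N α T Γ)
    (h : IsDRAOS pb px st N it) (hπ : π ∈ pb.domDual) {t : ℕ} (h1 : 1 ≤ t) (hN : t ≤ N)
    (i : Fin m) :
    st.w t * (inner ℝ (pb.A i (it.x t)) (π i - it.dual t i) - (pb.fstar i (π i)).toReal
        + (pb.fstar i (it.dual t i)).toReal)
      - st.w t * st.η t / 2 * ‖it.x t - it.x (t - 1)‖ ^ 2 + dualPotential st it T π i t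
      ≤ if t = 1 then T / 2 * ‖π i - it.dual 0 i‖ ^ 2 else dualPotential st it T π i (t - 1) := by
  have hw := hc.w_pos t h1
  have h0 := mul_le_mul_of_nonneg_left ((h.dual_prox h1 hN i).2 _ (hπ i).1 (hπ i).2) hw.le
  have hτ := hc.w_mul_τ t h1
  have hτ' : ∀ c, st.w t * (st.τ t / 2 * c) = T / 2 * c := fun c => by rw [← hτ]; ring
  rw [hτ', map_add, map_smul, inner_add_left, real_inner_smul_left] at h0
  rw [dualPotential, map_sub, inner_sub_left]
  split_ifs with ht
  · subst ht
    simp only [show 1 - 2 = 0 from rfl, sub_self, map_zero, inner_zero_left] at h0 ⊢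
    -- At t = 1 the truncated index 1 - 2 = 0 removes the extrapolation. The case a = 0 of
    -- `dual_cross` supplies the sign.
    have hsq : 0 ≤ T / 2 * ‖it.dual 1 i - it.dual 0 i‖ ^ 2 := by
      have := hc.dual_cross 1 le_rfl i _ (h.dual_mem 1 le_rfl hN i) _ (h.dual_zero i) 0
      simpa using this
    linarith
  · have hθ := hc.w_mul_θ t (by omega)
    have hmem : it.dual (t - 1) i ∈ pb.Dual i := h.dual_mem (t - 1) (by omega) (by omega) i
    have hcr := hc.dual_cross (t - 1) (by omega) i _ (h.dual_mem t h1 hN i) _ hmem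
      ‖it.x (t - 1) - it.x (t - 2)‖
    have hA := pb.inner_A_le (i := i) (it.x (t - 1) - it.x (t - 2)) (it.dual t i - it.dual (t - 1) i)
    have hA2 := (mul_le_mul_of_nonneg_left hA (hc.w_pos (t - 1) (by omega)).le).trans hcr
    rw [dualPotential, show t - 1 - 1 = t - 2 by omega]
    set a := pb.A i (it.x (t - 1) - it.x (t - 2))
    have e : inner ℝ a (π i - it.dual (t - 1) i)
        = inner ℝ a (π i - it.dual t i) + inner ℝ a (it.dual t i - it.dual (t - 1) i) := by
      rw [← inner_add_right]; congr 1; abel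
    rw [e]
    have hθ' : st.w t * (st.θ t * inner ℝ a (π i - it.dual t i))
        = st.w (t - 1) * inner ℝ a (π i - it.dual t i) := by rw [← hθ]; ring
    linarith

theorem sum_dual_step (hc : StepsizeConditions pb px st (it.M px) N α T Γ)
    (h : IsDRAOS pb px st N it) (hr : r ∈ pb.domP) (hπ : π ∈ pb.domDual) {t : ℕ} (h1 : 1 ≤ t)
    (hN : t ≤ N) :
    st.w t * (pb.saddle (it.x t) r π - pb.saddle (it.x t) r (it.dual t))
      - st.w t * st.η t / 2 * ‖it.x t - it.x (t - 1)‖ ^ 2 + ∑ i, r i * dualPotential st it T π i t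
      ≤ ∑ i, r i * (if t = 1 then T / 2 * ‖π i - it.dual 0 i‖ ^ 2
          else dualPotential st it T π i (t - 1)) := by
  have hs := pb.P_subset hr.1
  refine le_trans (le_of_eq ?_) (Finset.sum_le_sum fun i _ =>
    mul_le_mul_of_nonneg_left (dual_step hc h hπ h1 hN i) (hs.1 i))
  -- As r sums to 1, the borrowed squared increment of x is charged only once over all scenarios.
  have e1 : ∀ c : ℝ, c = ∑ i, r i * c := fun c => by rw [← Finset.sum_mul, hs.2, one_mul]
  simp only [Problem.saddle, mul_add, mul_sub, inner_sub_right, Finset.sum_add_distrib,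
    Finset.sum_sub_distrib, Finset.mul_sum]
  have e2 : ∀ c : Fin m → ℝ, ∑ i, r i * (st.w t * c i) = ∑ i, st.w t * (r i * c i) :=
    fun c => Finset.sum_congr rfl fun i _ => by ring
  rw [e2, e2, e2, e2, ← e1 (st.w t * st.η t / 2 * ‖it.x t - it.x (t - 1)‖ ^ 2)]
  ring

/-- One phase decreases the potential. -/
theorem phase_step (hc : StepsizeConditions pb px st (it.M px) N α T Γ)
    (h : IsDRAOS pb px st N it) (hα : SegmentConvex α pb.u) (hr : r ∈ pb.domP)
    (hπ : π ∈ pb.domDual) (hx : xs ∈ pb.domX) {t : ℕ} (h1 : 2 ≤ t) (hN : t ≤ N) :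
    st.w t * (pb.saddle (it.x t) r π - (pb.objective xs).toReal)
      + outerPotential px st it α T Γ r π xs t ≤ outerPotential px st it α T Γ r π xs (t - 1) := by
  have a1 := phase_progress_le (r := r) hc h hx (by omega) hN
  have a2 := sum_innerProgress_le hc h hα hr hx (by omega) hN (first_step hc h hα hr hx h1 hN)
  have a3 := sum_dual_step hc h hr hπ (by omega) hN
  have a4 := mul_le_mul_of_nonneg_right (hc.η_step t h1) (sq_nonneg ‖xs - it.x (t - 1)‖)
  simp only [show t ≠ 1 by omega, if_false] at a3
  rw [outerPotential, outerPotential]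
  linarith

theorem phase_one (hc : StepsizeConditions pb px st (it.M px) N α T Γ)
    (h : IsDRAOS pb px st N it) (hα : SegmentConvex α pb.u) (hr : r ∈ pb.domP)
    (hπ : π ∈ pb.domDual) (hx : xs ∈ pb.domX) (hN : 1 ≤ N) (hβ : 0 ≤ st.β 1 1) :
    st.w 1 * (pb.saddle (it.x 1) r π - (pb.objective xs).toReal)
      + outerPotential px st it α T Γ r π xs 1
      ≤ Γ * px.U r (it.p 1 0) + ∑ i, r i * (T / 2 * ‖π i - it.dual 0 i‖ ^ 2)
        + (st.w 1 * st.η 1 + st.innerWeight 1 * st.β 1 1) / 2 * ‖xs - it.x 0‖ ^ 2 := by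
  have a1 := phase_progress_le (r := r) hc h hx le_rfl hN
  have a2 := sum_innerProgress_le hc h hα hr hx le_rfl hN (initial_step hc h hα hr hx hN hβ)
  have a3 := sum_dual_step hc h hr hπ le_rfl hN
  simp only [if_true, Nat.sub_self] at a1 a3
  rw [outerPotential]
  linarith

/-- The cross terms that remain after the last phase are absorbed by Young's inequality, through
`cross_last` and `dual_cross`. -/
theorem outerPotential_nonneg (hc : StepsizeConditions pb px st (it.M px) N α T Γ)
    (h : IsDRAOS pb px st N it) (hr : r ∈ pb.domP) (hπ : π ∈ pb.domDual) (hN : 1 ≤ N) :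
    0 ≤ outerPotential px st it α T Γ r π xs N := by
  have hw := hc.w_pos N hN
  have hη := hc.η_nonneg N
  have hα := hc.α_nonneg
  have a1 : 0 ≤ innerPotential px st it α Γ r xs N (st.S N) := by
    have hp1 := h.p_mem_P hc.S_pos hN le_rfl (le_refl (st.S N))
    have hp2 := h.p_mem_P hc.S_pos hN le_rfl (show st.S N - 1 ≤ st.S N by omega)
    have hcr := hc.cross_last N hN le_rfl _ hp1 _ hp2 ‖it.y N (st.S N) - xs‖
    have hp := px.pair_le (pb.v (it.dual N)) (it.p N (st.S N) - it.p N (st.S N - 1))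
      (it.y N (st.S N) - xs)
    have hp' := (mul_le_mul_of_nonneg_left hp (hc.innerWeight_pos hN).le).trans hcr
    have hU := mul_nonneg hc.Γ_nonneg (px.U_nonneg hr.1 hp1)
    rw [innerPotential, norm_sub_rev xs]
    linarith
  have a2 : 0 ≤ ∑ i, r i * dualPotential st it T π i N := by
    refine Finset.sum_nonneg fun i _ => mul_nonneg ((pb.P_subset hr.1).1 i) ?_
    have hcr := hc.dual_cross N hN i _ (hπ i).1 _ (h.dual_mem N hN le_rfl i)
      ‖it.x N - it.x (N - 1)‖
    have hA := (mul_le_mul_of_nonneg_left (pb.inner_A_le (i := i) (it.x N - it.x (N - 1))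
      (π i - it.dual N i)) hw.le).trans hcr
    rw [dualPotential]
    linarith
  rw [outerPotential]
  positivity

/-- The convergence rate of the method under `StepsizeConditions`. -/
theorem objective_average_sub_le (hc : StepsizeConditions pb px st (it.M px) N α T Γ)
    (h : IsDRAOS pb px st N it) (hα : SegmentConvex α pb.u) (hx : xs ∈ pb.domX) (hN : 1 ≤ N)
    (hβ : 0 ≤ st.β 1 1) (hT : 0 ≤ T) {R₀ : ℝ} (hR : ‖it.x 0 - xs‖ ≤ R₀) {K : ℝ}
    (hK : Γ * px.DP ^ 2 / 2 + T * pb.DDual ^ 2 / 2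
      + (st.w 1 * st.η 1 + st.innerWeight 1 * st.β 1 1) / 2 * R₀ ^ 2
      ≤ (∑ t ∈ Finset.Icc 1 N, st.w t) * K) :
    pb.objective (it.average st N) - pb.objective xs ≤ (K : EReal) := by
  have hW : 0 < ∑ t ∈ Finset.Icc 1 N, st.w t :=
    Finset.sum_pos (fun t ht => hc.w_pos t (Finset.mem_Icc.1 ht).1) ⟨1, by simp [hN]⟩
  refine pb.objective_sub_le (h.average_mem_domX hc.S_pos hc.q_eq_one hc.w_pos hN) hx
    fun r hr π hπ => ?_
  refine le_of_mul_le_mul_left (le_trans ?_ hK) hW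
  have a1 := sum_Icc_add_le_of_telescope
    (F := fun t => st.w t * (pb.saddle (it.x t) r π - (pb.objective xs).toReal))
    (G := outerPotential px st it α T Γ r π xs) hN (phase_one hc h hα hr hπ hx hN hβ)
    fun t ht htN => phase_step hc h hα hr hπ hx ht htN
  have a2 := outerPotential_nonneg (xs := xs) hc h hr hπ hN
  have a3 := h.map_average_le hc.S_pos hc.q_eq_one hc.w_pos hN (pb.convexOn_saddle r π)
  simp only [mul_sub, Finset.sum_sub_distrib, ← Finset.sum_mul] at a1
  have b1 := mul_le_mul_of_nonneg_left (px.U_le hr.1 h.p_init) hc.Γ_nonneg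
  have hs := pb.P_subset hr.1
  have b2 : ∑ i, r i * (T / 2 * ‖π i - it.dual 0 i‖ ^ 2) ≤ T * pb.DDual ^ 2 / 2 := by
    calc _ ≤ ∑ i, r i * (T / 2 * pb.DDual ^ 2) := by
          refine Finset.sum_le_sum fun i _ => mul_le_mul_of_nonneg_left ?_ (hs.1 i)
          gcongr
          exact pb.norm_sub_le_DDual (hπ i).1 (h.dual_zero i)
      _ = _ := by rw [← Finset.sum_mul, hs.2]; ring
  have b3 : (st.w 1 * st.η 1 + st.innerWeight 1 * st.β 1 1) / 2 * ‖xs - it.x 0‖ ^ 2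
      ≤ (st.w 1 * st.η 1 + st.innerWeight 1 * st.β 1 1) / 2 * R₀ ^ 2 := by
    have h1 := hc.w_pos 1 le_rfl
    have h2 := hc.η_nonneg 1
    have h3 := hc.innerWeight_pos (le_refl 1)
    rw [norm_sub_rev]
    gcongr
  rw [mul_sub]
  linarith

end Descent

/-- Young's inequality from the square of √A |b| - √B |a|. It reduces every cross condition to
comparing c² with a product of two coefficients. -/
theorem mul_mul_le_of_sq_le {A B c : ℝ} (hA : 0 ≤ A) (hB : 0 ≤ B) (h : c ^ 2 ≤ A * B) (a b : ℝ) :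
    c * (a * b) ≤ A / 2 * b ^ 2 + B / 2 * a ^ 2 := by
  have hc : |c| ≤ √A * √B := by
    rw [← Real.sqrt_mul hA]; exact Real.abs_le_sqrt h
  have h1 : c * (a * b) ≤ (√A * √B) * (|a| * |b|) := by
    calc c * (a * b) ≤ |c * (a * b)| := le_abs_self _
      _ = |c| * (|a| * |b|) := by rw [abs_mul, abs_mul]
      _ ≤ _ := by gcongr
  have h2 : 0 ≤ A * b ^ 2 + B * a ^ 2 - 2 * ((√A * √B) * (|a| * |b|)) := by
    rw [← sq_abs a, ← sq_abs b]
    nth_rewrite 1 [← Real.sq_sqrt hA]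
    nth_rewrite 1 [← Real.sq_sqrt hB]
    have := sq_nonneg (√A * |b| - √B * |a|)
    linarith
  linarith

theorem one_le_innerLimit (a : ℝ) : 1 ≤ innerLimit a := le_max_left _ _

theorem le_innerLimit (a : ℝ) : a ≤ innerLimit a :=
  (Nat.le_ceil a).trans (by exact_mod_cast le_max_right _ _)

theorem innerLimit_pos (a : ℝ) : (0 : ℝ) < innerLimit a := by
  exact_mod_cast one_le_innerLimit a

theorem innerLimit_le {a : ℝ} (ha : 0 ≤ a) : (innerLimit a : ℝ) ≤ 1 + a := by
  rw [innerLimit, Nat.cast_max]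
  refine max_le (by simpa using ha) ?_
  linarith [Nat.ceil_lt_add_one ha]

theorem pProjections_le {st : Stepsizes} {N : ℕ} {B : ℝ}
    (h : ∀ t, 1 ≤ t → t ≤ N → (st.S t : ℝ) ≤ B) : (pProjections st N : ℝ) ≤ N * B := by
  rw [pProjections, Nat.cast_sum]
  refine (Finset.sum_le_sum fun t ht => h t (Finset.mem_Icc.1 ht).1 (Finset.mem_Icc.1 ht).2).trans ?_
  simp

variable {n m : ℕ} {pb : Problem n m} {px : ProxSetup pb.P}

/-! ### Stepsizes and rate for merely convex u -/

section Convex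

variable {it : Iterates pb} {R₀ Δ : ℝ}

theorem convexStepsizes_conditions (hR : 0 < R₀) (hΔ : 0 < Δ) (N : ℕ) :
    StepsizeConditions pb px (convexStepsizes pb.MA pb.DDual px.DP R₀ Δ (it.M px)) (it.M px) N 0
      (pb.MA * R₀ / pb.DDual) (R₀ / Δ / px.DP) := by
  have hMA := pb.MA_nonneg
  have hD := pb.DDual_nonneg
  have hDP := px.DP_nonneg
  have hS := fun t => innerLimit_pos (it.M px t * Δ)
  -- The factor S_t in β cancels against the inner weight 1/S_t, so the product is the same in all
  -- phases.
  have hβ : ∀ t s, (convexStepsizes pb.MA pb.DDual px.DP R₀ Δ (it.M px)).innerWeight t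
      * (convexStepsizes pb.MA pb.DDual px.DP R₀ Δ (it.M px)).β t s = px.DP / Δ / R₀ := by
    intro t s
    have := (hS t).ne'
    simp only [Stepsizes.innerWeight, convexStepsizes]
    field_simp
  have hcross : ∀ t, ∀ p ∈ pb.P, ∀ p' ∈ pb.P, ∀ b : ℝ,
      (convexStepsizes pb.MA pb.DDual px.DP R₀ Δ (it.M px)).innerWeight t
        * (it.M px t * (px.normU (p - p') * b))
      ≤ px.DP / Δ / R₀ / 2 * b ^ 2 + R₀ / Δ / px.DP / 2 * px.normU (p - p') ^ 2 := by
    intro t p hp p' hp' b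
    rcases hDP.eq_or_lt with h0 | h0
    · have : px.normU (p - p') = 0 :=
        le_antisymm ((px.normU_sub_le_DP hp hp').trans h0.ge) (apply_nonneg _ _)
      simp [this, ← h0]
    rw [← mul_assoc]
    refine mul_mul_le_of_sq_le (by positivity) (by positivity) ?_ _ _
    have hM : 0 ≤ it.M px t := px.opNorm_nonneg _
    -- The coefficients multiply to 1/Δ², and S_t ≥ M_t Δ gives M_t / S_t ≤ 1/Δ.
    have e : px.DP / Δ / R₀ * (R₀ / Δ / px.DP) = (1 / Δ) ^ 2 := by field_simp
    rw [e]
    have h1 : it.M px t / innerLimit (it.M px t * Δ) ≤ 1 / Δ := by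
      rw [div_le_div_iff₀ (hS t) hΔ, one_mul]
      exact le_innerLimit _
    have h2 : 0 ≤ it.M px t / innerLimit (it.M px t * Δ) := div_nonneg hM (hS t).le
    simp only [Stepsizes.innerWeight, convexStepsizes]
    rw [one_div_mul_eq_div]
    gcongr
  exact {
    α_nonneg := le_rfl
    w_pos := fun _ _ => one_pos
    S_pos := fun _ => one_le_innerLimit _
    q_eq_one := fun _ _ => rfl
    η_nonneg := fun _ => div_nonneg (mul_nonneg hMA hD) hR.le
    Γ_nonneg := by positivity
    w_mul_θ := fun _ _ => one_mul 1
    w_mul_τ := fun _ _ => one_mul _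
    dual_cross := by
      intro t _ i π hπ π' hπ' a
      simp only [convexStepsizes, one_mul]
      rcases hD.eq_or_lt with h0 | h0
      · have : ‖π - π'‖ = 0 :=
          le_antisymm ((pb.norm_sub_le_DDual hπ hπ').trans h0.ge) (norm_nonneg _)
        simp [this, ← h0]
      · refine mul_mul_le_of_sq_le (by positivity) (by positivity) (le_of_eq ?_) _ _
        field_simp
    η_step := fun _ _ => by simp [convexStepsizes]
    δ_first := by
      intro t ht
      have h1 := (hS t).ne'
      have h2 := (hS (t - 1)).ne'
      simp only [Stepsizes.innerWeight, convexStepsizes, ht, and_self, if_true]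
      field_simp
    δ_inner := by
      intro t s hs
      simp only [convexStepsizes]
      rw [if_neg (by omega)]
    γ_eq := by
      intro t s _
      have := (hS t).ne'
      simp only [Stepsizes.innerWeight, convexStepsizes]
      field_simp
    β_inner := fun _ _ _ _ => by simp [convexStepsizes]
    β_first := fun t _ => by rw [zero_div, add_zero, hβ, hβ]
    cross_inner := fun t s _ _ _ p hp p' hp' b => by
      rw [hβ]; exact hcross t p hp p' hp' b
    cross_first := fun t _ _ p hp p' hp' b => by
      rw [hβ]; exact hcross (t - 1) p hp p' hp' b
    cross_last := fun t _ _ p hp p' hp' b => by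
      rw [zero_div, add_zero, hβ]; exact hcross t p hp p' hp' b }

theorem convex_rate {xstar : Vec n} (hx : xstar ∈ pb.domX) (hR₀ : ‖it.x 0 - xstar‖ ≤ R₀)
    (hR : 0 < R₀) (hΔ : 0 < Δ) {N : ℕ} (hN : 1 ≤ N)
    (h : IsDRAOS pb px (convexStepsizes pb.MA pb.DDual px.DP R₀ Δ (it.M px)) N it) :
    pb.objective (it.average (convexStepsizes pb.MA pb.DDual px.DP R₀ Δ (it.M px)) N)
        - pb.objective xstar
      ≤ ((pb.MA * pb.DDual * R₀ / N + px.DP * R₀ / (Δ * N) : ℝ) : EReal) := by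
  have hMA := pb.MA_nonneg
  have hD := pb.DDual_nonneg
  have hDP := px.DP_nonneg
  have hN' : (0 : ℝ) < N := by exact_mod_cast hN
  have hS := innerLimit_pos (it.M px 1 * Δ)
  refine objective_average_sub_le (convexStepsizes_conditions hR hΔ N) h
    pb.u_pcc.segmentConvex hx hN ?_ (by positivity) hR₀ (le_of_eq ?_)
  · simp only [convexStepsizes]; positivity
  · have e1 : R₀ / Δ / px.DP * px.DP ^ 2 = R₀ / Δ * px.DP := by
      rcases hDP.eq_or_lt with h0 | h0
      · simp [← h0]
      · field_simp
    have e2 : pb.MA * R₀ / pb.DDual * pb.DDual ^ 2 = pb.MA * R₀ * pb.DDual := by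
      rcases hD.eq_or_lt with h0 | h0
      · simp [← h0]
      · field_simp
    rw [e1, e2]
    simp only [Stepsizes.innerWeight, convexStepsizes, Finset.sum_const, Nat.card_Icc,
      Nat.add_sub_cancel, nsmul_eq_mul, mul_one]
    generalize (innerLimit (it.M px 1 * Δ) : ℝ) = S at hS
    field_simp
    ring

end Convex

/-! ### Stepsizes and rate for strongly convex u -/

section StronglyConvex

variable {it : Iterates pb} {R₀ Δ α : ℝ}

theorem strongStepsizes_conditions (hα : 0 < α) {N : ℕ}
    (hM : ∀ t, 1 ≤ t → t ≤ N → it.M px t ≤ MTilde pb px) :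
    StepsizeConditions pb px (strongStepsizes α pb.MA (MTilde pb px) Δ) (it.M px) N α
      (6 * pb.MA ^ 2 / α)
      (4 * MTilde pb px ^ 2 / (α * innerLimit (Δ * MTilde pb px ^ 2))) := by
  have hMA := pb.MA_nonneg
  have hMt := MTilde_nonneg pb px
  have hS := innerLimit_pos (Δ * MTilde pb px ^ 2)
  have hM0 : ∀ t, 0 ≤ it.M px t := fun t => px.opNorm_nonneg _
  have hcast : ∀ t : ℕ, 1 ≤ t → (1 : ℝ) ≤ t := fun t ht => by exact_mod_cast ht
  have hpred : ∀ t : ℕ, 1 ≤ t → ((t - 1 : ℕ) : ℝ) = t - 1 := fun t ht => by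
    rw [Nat.cast_sub ht, Nat.cast_one]
  have hβ : ∀ t s : ℕ, α / 4 * ((t : ℝ) - 1) ≤ (strongStepsizes α pb.MA (MTilde pb px) Δ).β t s := by
    intro t s
    simp only [strongStepsizes]
    split_ifs
    · exact le_rfl
    · gcongr; linarith
  -- The threshold on B makes its product with Γ at least (t M̃ / S)², S being the common inner
  -- limit. All three cross conditions reduce to it.
  have hcross : ∀ t, 1 ≤ t → t ≤ N → ∀ B : ℝ,
      t ^ 2 * α / (4 * innerLimit (Δ * MTilde pb px ^ 2)) ≤ B → ∀ a b : ℝ,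
      (strongStepsizes α pb.MA (MTilde pb px) Δ).innerWeight t * (it.M px t * (a * b))
        ≤ B / 2 * b ^ 2
          + 4 * MTilde pb px ^ 2 / (α * innerLimit (Δ * MTilde pb px ^ 2)) / 2 * a ^ 2 := by
    intro t h1 hN B hB a b
    rw [← mul_assoc]
    refine mul_mul_le_of_sq_le (le_trans (by positivity) hB) (by positivity)
      (le_trans ?_ (mul_le_mul_of_nonneg_right hB (by positivity))) _ _
    have h2 := hM t h1 hN
    have h3 := hM0 t
    have e : (t : ℝ) ^ 2 * α / (4 * innerLimit (Δ * MTilde pb px ^ 2))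
        * (4 * MTilde pb px ^ 2 / (α * innerLimit (Δ * MTilde pb px ^ 2)))
        = (t / innerLimit (Δ * MTilde pb px ^ 2) * MTilde pb px) ^ 2 := by
      field_simp
    rw [e]
    simp only [Stepsizes.innerWeight, strongStepsizes]
    gcongr
  exact {
    α_nonneg := hα.le
    w_pos := fun t ht => by
      have := hcast t ht
      simp only [strongStepsizes]; linarith
    S_pos := fun _ => one_le_innerLimit _
    q_eq_one := fun _ _ => rfl
    η_nonneg := fun t => by simp only [strongStepsizes]; positivity
    Γ_nonneg := by positivity
    w_mul_θ := by
      intro t ht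
      have := hcast t (by omega)
      simp only [strongStepsizes, hpred t (by omega)]
      field_simp
    w_mul_τ := by
      intro t ht
      have := hcast t ht
      simp only [strongStepsizes]
      field_simp
    dual_cross := by
      intro t ht i π _ π' _ a
      simp only [strongStepsizes]
      rw [← mul_assoc]
      refine mul_mul_le_of_sq_le (by positivity) (by positivity) (le_of_eq ?_) _ _
      field_simp
    η_step := by
      intro t ht
      have h2 : (2 : ℝ) ≤ t := by exact_mod_cast ht
      simp only [strongStepsizes, hpred t (by omega)]
      -- The condition reads t² ≤ (t - 1)(t + 2), that is, t ≥ 2.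
      have : 0 ≤ α * (t - 2) := mul_nonneg hα.le (by linarith)
      linarith
    δ_first := by
      intro t ht
      have := hcast t (by omega)
      simp only [Stepsizes.innerWeight, strongStepsizes, hpred t (by omega), if_true]
      field_simp
    δ_inner := by
      intro t s hs
      simp only [strongStepsizes]
      rw [if_neg (by omega)]
    γ_eq := by
      intro t s ht
      have := hcast t ht
      simp only [Stepsizes.innerWeight, strongStepsizes]
      field_simp
    β_inner := by
      intro t s _ hs
      have := hβ t (s - 1)
      have e : (strongStepsizes α pb.MA (MTilde pb px) Δ).β t s = α / 4 * t := by
        simp only [strongStepsizes]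
        rw [if_neg (by omega)]
      rw [e]
      linarith
    β_first := by
      intro t ht
      have h2 : (2 : ℝ) ≤ t := by exact_mod_cast ht
      have h1 := hβ (t - 1) ((strongStepsizes α pb.MA (MTilde pb px) Δ).S (t - 1))
      rw [hpred t (by omega)] at h1
      -- In phase t - 1 every β is at least α(t - 2)/4, whichever inner index is last; adding α/2
      -- gives exactly αt/4.
      have h3 : α / 4 * t ≤ (strongStepsizes α pb.MA (MTilde pb px) Δ).β (t - 1)
          ((strongStepsizes α pb.MA (MTilde pb px) Δ).S (t - 1)) + α / 2 := by linarith
      have hw : 0 ≤ (strongStepsizes α pb.MA (MTilde pb px) Δ).innerWeight (t - 1) := by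
        simp only [Stepsizes.innerWeight, strongStepsizes]; positivity
      refine le_trans (le_of_eq ?_) (mul_le_mul_of_nonneg_left h3 hw)
      simp only [Stepsizes.innerWeight, strongStepsizes, hpred t (by omega), if_true]
      ring
    cross_inner := by
      intro t s h1 hN hs p _ p' _ b
      refine hcross t h1 hN _ (le_of_eq ?_) _ b
      simp only [Stepsizes.innerWeight, strongStepsizes]
      rw [if_neg (by omega)]
      field_simp
    cross_first := by
      intro t h1 hN p _ p' _ b
      refine hcross (t - 1) (by omega) (by omega) _ ?_ _ b
      have h2 : (2 : ℝ) ≤ t := by exact_mod_cast h1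
      simp only [Stepsizes.innerWeight, strongStepsizes, hpred t (by omega), if_true]
      have e : (t : ℝ) / innerLimit (Δ * MTilde pb px ^ 2) * (α / 4 * (t - 1))
          = t * (t - 1) * α / (4 * innerLimit (Δ * MTilde pb px ^ 2)) := by
        field_simp
      rw [e]
      have : ((t : ℝ) - 1) ^ 2 ≤ t * (t - 1) := by nlinarith
      gcongr
    cross_last := by
      intro t h1 hN p _ p' _ b
      refine hcross t h1 hN _ ?_ _ b
      have h2 := hcast t h1
      have h3 : α / 4 * t ≤ (strongStepsizes α pb.MA (MTilde pb px) Δ).β t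
          ((strongStepsizes α pb.MA (MTilde pb px) Δ).S t) + α / 2 := by
        linarith [hβ t ((strongStepsizes α pb.MA (MTilde pb px) Δ).S t)]
      have hw : 0 ≤ (strongStepsizes α pb.MA (MTilde pb px) Δ).innerWeight t := by
        simp only [Stepsizes.innerWeight, strongStepsizes]; positivity
      refine le_trans (le_of_eq ?_) (mul_le_mul_of_nonneg_left h3 hw)
      simp only [Stepsizes.innerWeight, strongStepsizes]
      field_simp }

theorem sum_Icc_cast (N : ℕ) : ∑ t ∈ Finset.Icc 1 N, (t : ℝ) = N * (N + 1) / 2 := by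
  induction N with
  | zero => simp
  | succ N ih =>
    rw [Finset.sum_Icc_succ_top (by omega), ih]
    push_cast
    ring

theorem strong_rate {xstar : Vec n} (hx : xstar ∈ pb.domX) (hR₀ : ‖it.x 0 - xstar‖ ≤ R₀)
    (hα : 0 < α) (hu : StronglyConvex α pb.u) (hΔ : 0 < Δ) {N : ℕ} (hN : 1 ≤ N)
    (h : IsDRAOS pb px (strongStepsizes α pb.MA (MTilde pb px) Δ) N it) :
    pb.objective (it.average (strongStepsizes α pb.MA (MTilde pb px) Δ) N) - pb.objective xstar
      ≤ ((1 / (N * (N + 1)) * (α / 6 * R₀ ^ 2 + 6 * pb.MA ^ 2 * pb.DDual ^ 2 / α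
          + 4 * px.DP ^ 2 / (α * Δ)) : ℝ) : EReal) := by
  have hN' : (0 : ℝ) < N := by exact_mod_cast hN
  have hS := innerLimit_pos (Δ * MTilde pb px ^ 2)
  refine objective_average_sub_le (strongStepsizes_conditions hα fun t h1 htN =>
    opNorm_le_MTilde pb px (h.dual_mem t h1 htN)) h
    (hu.segmentConvex pb.u_pcc) hx hN ?_ (by positivity) hR₀ ?_
  · simp [strongStepsizes]
  -- The inner limit is at least Δ M̃², hence Γ ≤ 4/(αΔ).
  · have e1 : 4 * MTilde pb px ^ 2 / (α * innerLimit (Δ * MTilde pb px ^ 2)) ≤ 4 / (α * Δ) := by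
      rw [div_le_div_iff₀ (by positivity) (by positivity)]
      have := mul_le_mul_of_nonneg_left (le_innerLimit (Δ * MTilde pb px ^ 2)) hα.le
      linarith
    have e2 := mul_le_mul_of_nonneg_right e1 (sq_nonneg px.DP)
    have e3 : (N : ℝ) * (N + 1) / 2 * (1 / (N * (N + 1)) * (α / 6 * R₀ ^ 2
        + 6 * pb.MA ^ 2 * pb.DDual ^ 2 / α + 4 * px.DP ^ 2 / (α * Δ)))
        = (α / 6 * R₀ ^ 2 + 6 * pb.MA ^ 2 / α * pb.DDual ^ 2 + 4 / (α * Δ) * px.DP ^ 2) / 2 := by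
      field_simp
    have e4 : ∑ t ∈ Finset.Icc 1 N, (strongStepsizes α pb.MA (MTilde pb px) Δ).w t
        = N * (N + 1) / 2 := sum_Icc_cast N
    rw [e4, e3]
    have e5 : (strongStepsizes α pb.MA (MTilde pb px) Δ).β 1 1 = 0 := by simp [strongStepsizes]
    have e6 : (strongStepsizes α pb.MA (MTilde pb px) Δ).w 1
        * (strongStepsizes α pb.MA (MTilde pb px) Δ).η 1 = α / 6 := by simp [strongStepsizes]
    rw [e5, e6, mul_zero, add_zero]
    linarith

end StronglyConvex

end DRAOS

end

/-! ### The rates and complexity bounds -/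

theorem mainTheorem6 {n m : ℕ} (pb : DRAOS.Problem n m) (px : DRAOS.ProxSetup pb.P)
    (xstar : DRAOS.Vec n) (hxstar : pb.IsOptimal xstar)
    (it : DRAOS.Iterates pb) (R₀ : ℝ) (hR₀ : ‖it.x 0 - xstar‖ ≤ R₀)
    (Δ : ℝ) (hΔ : 0 < Δ) :
    -- (a) `u` merely convex
    (∀ st : DRAOS.Stepsizes,
      st = DRAOS.convexStepsizes pb.MA pb.DDual px.DP R₀ Δ (it.M px) → 0 < R₀ →
      ∀ N : ℕ, 1 ≤ N → DRAOS.IsDRAOS pb px st N it →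
        pb.objective (it.average st N) - pb.objective xstar
          ≤ ((pb.MA * pb.DDual * R₀ / N + px.DP * R₀ / (Δ * N) : ℝ) : EReal) ∧
        (Δ = px.DP / (pb.MA * pb.DDual) →
          pb.objective (it.average st N) - pb.objective xstar
            ≤ ((2 * pb.MA * pb.DDual * R₀ / N : ℝ) : EReal) ∧
          ∀ ε : ℝ, 0 < ε → N = ⌈2 * pb.MA * pb.DDual * R₀ / ε⌉₊ →
            it.average st N ∈ pb.X ∧
            pb.objective (it.average st N) - pb.objective xstar ≤ (ε : EReal) ∧
            (DRAOS.commRounds N : ℝ) ≤ 2 * (2 * pb.MA * pb.DDual * R₀ / ε + 1) ∧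
            (DRAOS.pProjections st N : ℝ)
              ≤ (2 * pb.MA * pb.DDual * R₀ / ε + 1)
                * (1 + DRAOS.MTilde pb px * px.DP / (pb.MA * pb.DDual)))) ∧
    -- (b) `u` strongly convex with modulus `α > 0`
    (∀ α : ℝ, 0 < α → DRAOS.StronglyConvex α pb.u → ∀ st : DRAOS.Stepsizes,
      st = DRAOS.strongStepsizes α pb.MA (DRAOS.MTilde pb px) Δ →
      ∀ N : ℕ, 1 ≤ N → DRAOS.IsDRAOS pb px st N it →
        pb.objective (it.average st N) - pb.objective xstar
          ≤ ((1 / (N * (N + 1)) * (α / 6 * R₀ ^ 2 + 6 * pb.MA ^ 2 * pb.DDual ^ 2 / α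
              + 4 * px.DP ^ 2 / (α * Δ)) : ℝ) : EReal) ∧
        (Δ = px.DP ^ 2 / (pb.MA ^ 2 * pb.DDual ^ 2 + α ^ 2 * R₀ ^ 2 / 6) →
          pb.objective (it.average st N) - pb.objective xstar
            ≤ ((1 / (N * (N + 1)) * (α * R₀ ^ 2 + 10 * pb.MA ^ 2 * pb.DDual ^ 2 / α) : ℝ)
                : EReal) ∧
          ∀ ε : ℝ, 0 < ε →
            N = ⌈√((α * R₀ ^ 2 + 10 * pb.MA ^ 2 * pb.DDual ^ 2 / α) / ε)⌉₊ →
            it.average st N ∈ pb.X ∧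
            pb.objective (it.average st N) - pb.objective xstar ≤ (ε : EReal) ∧
            (DRAOS.commRounds N : ℝ)
              ≤ 2 * (√((α * R₀ ^ 2 + 10 * pb.MA ^ 2 * pb.DDual ^ 2 / α) / ε) + 1) ∧
            (DRAOS.pProjections st N : ℝ)
              ≤ (√((α * R₀ ^ 2 + 10 * pb.MA ^ 2 * pb.DDual ^ 2 / α) / ε) + 1)
                * (1 + DRAOS.MTilde pb px ^ 2 * px.DP ^ 2
                    / (pb.MA ^ 2 * pb.DDual ^ 2 + α ^ 2 * R₀ ^ 2 / 6)))) := by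
  have hx := hxstar.mem_domX
  have hMA := pb.MA_nonneg
  have hD := pb.DDual_nonneg
  have hDP := px.DP_nonneg
  have hMt := DRAOS.MTilde_nonneg pb px
  constructor
  · rintro st rfl hR N hN h
    have hN' : (0 : ℝ) < N := by exact_mod_cast hN
    have hrate := DRAOS.convex_rate hx hR₀ hR hΔ hN h
    refine ⟨hrate, fun hΔeq => ?_⟩
    -- Division by 0 gives 0, so Δ > 0 already forces the denominator and `DP` to be positive.
    have hquot : 0 < px.DP / (pb.MA * pb.DDual) := hΔeq ▸ hΔ
    have hMD : 0 < pb.MA * pb.DDual := (mul_nonneg hMA hD).lt_of_ne fun h0 => by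
      simp [← h0] at hquot
    have hDP' : 0 < px.DP := hDP.lt_of_ne fun h0 => by simp [← h0] at hquot
    have hval : pb.MA * pb.DDual * R₀ / N + px.DP * R₀ / (Δ * N)
        = 2 * pb.MA * pb.DDual * R₀ / N := by
      have e : px.DP = Δ * (pb.MA * pb.DDual) := by
        rw [hΔeq, div_mul_cancel₀ _ hMD.ne']
      rw [e]
      field_simp
      ring
    rw [hval] at hrate
    refine ⟨hrate, fun ε hε hNε => ?_⟩
    have hle : 2 * pb.MA * pb.DDual * R₀ / ε ≤ N := by rw [hNε]; exact Nat.le_ceil _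
    have hlt : (N : ℝ) ≤ 2 * pb.MA * pb.DDual * R₀ / ε + 1 := by
      rw [hNε]; exact (Nat.ceil_lt_add_one (by positivity)).le
    refine ⟨?_, hrate.trans (EReal.coe_le_coe_iff.2 ?_), ?_, ?_⟩
    · have hc := DRAOS.convexStepsizes_conditions (px := px) (it := it) hR hΔ N
      exact (h.average_mem_domX hc.S_pos hc.q_eq_one hc.w_pos hN).1
    · rw [div_le_iff₀ hε] at hle
      rw [div_le_iff₀ hN', mul_comm ε]
      exact hle
    · rw [DRAOS.commRounds, Nat.cast_mul, Nat.cast_ofNat]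
      linarith
    · refine (DRAOS.pProjections_le
        (B := 1 + DRAOS.MTilde pb px * px.DP / (pb.MA * pb.DDual)) fun t h1 htN => ?_).trans
        (mul_le_mul_of_nonneg_right hlt (by positivity))
      have hM : it.M px t ≤ DRAOS.MTilde pb px :=
        DRAOS.opNorm_le_MTilde pb px (h.dual_mem t h1 htN)
      have hM0 : 0 ≤ it.M px t := px.opNorm_nonneg _
      refine (DRAOS.innerLimit_le (mul_nonneg hM0 hΔ.le)).trans ?_
      rw [mul_div_assoc, ← hΔeq]
      gcongr
  · rintro α hα hu st rfl N hN h
    have hN' : (0 : ℝ) < N := by exact_mod_cast hN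
    have hrate := DRAOS.strong_rate hx hR₀ hα hu hΔ hN h
    refine ⟨hrate, fun hΔeq => ?_⟩
    set G := pb.MA ^ 2 * pb.DDual ^ 2 + α ^ 2 * R₀ ^ 2 / 6 with hG
    set C := α * R₀ ^ 2 + 10 * pb.MA ^ 2 * pb.DDual ^ 2 / α with hC
    have hG0 : 0 ≤ G := by positivity
    have hC0 : 0 ≤ C := by positivity
    have hquot : 0 < px.DP ^ 2 / G := hΔeq ▸ hΔ
    have hG' : 0 < G := hG0.lt_of_ne fun h0 => by simp [← h0] at hquot
    have hDPG : px.DP ^ 2 = Δ * G := by rw [hΔeq, div_mul_cancel₀ _ hG'.ne']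
    have hbound : α / 6 * R₀ ^ 2 + 6 * pb.MA ^ 2 * pb.DDual ^ 2 / α + 4 * px.DP ^ 2 / (α * Δ)
        ≤ C := by
      -- This term equals 4G/α. Its share 2/3 of αR₀², added to 1/6, stays below the coefficient 1
      -- in C.
      have e : 4 * px.DP ^ 2 / (α * Δ)
          = 4 * pb.MA ^ 2 * pb.DDual ^ 2 / α + 2 / 3 * (α * R₀ ^ 2) := by
        rw [hDPG, hG]
        field_simp
        ring
      have h0 : 0 ≤ α * R₀ ^ 2 := by positivity
      rw [e, hC]
      linarith [show 10 * pb.MA ^ 2 * pb.DDual ^ 2 / α = 6 * pb.MA ^ 2 * pb.DDual ^ 2 / α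
        + 4 * pb.MA ^ 2 * pb.DDual ^ 2 / α by ring]
    have hrate2 : pb.objective (it.average (DRAOS.strongStepsizes α pb.MA (DRAOS.MTilde pb px) Δ) N)
        - pb.objective xstar ≤ ((1 / (N * (N + 1)) * C : ℝ) : EReal) :=
      hrate.trans (EReal.coe_le_coe_iff.2 (mul_le_mul_of_nonneg_left hbound (by positivity)))
    refine ⟨hrate2, fun ε hε hNε => ?_⟩
    have hle : √(C / ε) ≤ N := by rw [hNε]; exact Nat.le_ceil _
    have hlt : (N : ℝ) ≤ √(C / ε) + 1 := by
      rw [hNε]; exact (Nat.ceil_lt_add_one (Real.sqrt_nonneg _)).le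
    refine ⟨?_, hrate2.trans (EReal.coe_le_coe_iff.2 ?_), ?_, ?_⟩
    · have hc := DRAOS.strongStepsizes_conditions (px := px) (it := it) (Δ := Δ) hα fun t h1 htN =>
        DRAOS.opNorm_le_MTilde pb px (h.dual_mem t h1 htN)
      exact (h.average_mem_domX hc.S_pos hc.q_eq_one hc.w_pos hN).1
    -- N² ≥ C/ε suffices, since N(N + 1) ≥ N².
    · have h1 : C / ε ≤ (N : ℝ) ^ 2 := (Real.sqrt_le_left hN'.le).1 hle
      rw [div_le_iff₀ hε] at h1
      rw [one_div_mul_eq_div, div_le_iff₀ (by positivity)]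
      have : 0 ≤ ε * N := by positivity
      linarith
    · rw [DRAOS.commRounds, Nat.cast_mul, Nat.cast_ofNat]
      linarith
    · refine (DRAOS.pProjections_le
        (B := 1 + DRAOS.MTilde pb px ^ 2 * px.DP ^ 2 / G) fun t h1 htN => ?_).trans
        (mul_le_mul_of_nonneg_right hlt (by positivity))
      refine (DRAOS.innerLimit_le (by positivity)).trans (le_of_eq ?_)
      rw [mul_div_assoc, ← hΔeq, mul_comm Δ]
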